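/- **Conventions.** All spaces are Hausdorff. The empty set is regarded as connected. A subset of a space is *bounded* if its closure is compact. A subset $A$ of a noncompact locally compact space $X$ is *solid* if $A$ is connected and every connected component of $X\setminus A$ is unbounded; a subset $A$ of a compact space $X$ is *solid* if $A$ and $X\setminus A$ are connected. Let $\mathscr K_s(X)$ be the family of compact solid sets, $\mathscr O_s^*(X)$ the family of bounded open solid sets, and $\mathscr A_s^*(X)=\mathscr K_s(X)\cup\mathscr O_s^*(X)$. The symbol $\bigsqcup$ denotes a union of pairwise disjoint sets. A *solid-set function* on a locally compact space $X$ is a function $\lambda:\mathscr A_s^*(X)\to[0,\infty)$ such that 1. $\sum_{i=1}^n\lambda(C_i)\le\lambda(C)$ whenever $\bigsqcup_{i=1}^n C_i\subseteq C$ with $C,C_i\in\mathscr K_s(X)$; 2. $\lambda(U)=\sup\{\lambda(K): K\subseteq U,\ K\in\mathscr K_s(X)\}$ for $U\in\mathscr O_s^*(X)$; 3. $\lambda(K)=\inf\{\lambda(U): K\subseteq U,\ U\in\mathscr O_s^*(X)\}$ for $K\in\mathscr K_s(X)$; 4. $\lambda(A)=\sum_{i=1}^n\lambda(A_i)$ whenever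 $A=\bigsqcup_{i=1}^n A_i$ with $A,A_i\in\mathscr A_s^*(X)$. A *topological measure* on a locally compact space $X$ is a function $\mu$, not identically $\infty$, from the open subsets and the closed subsets of $X$ to $[0,\infty]$ such that 1. $\mu(A\sqcup B)=\mu(A)+\mu(B)$ whenever $A$, $B$ are disjoint and each of $A$, $B$, $A\sqcup B$ is compact or open; 2. $\mu(U)=\sup\{\mu(K): K\subseteq U,\ K \text{ compact}\}$ for open $U$; 3. $\mu(F)=\inf\{\mu(U): F\subseteq U,\ U \text{ open}\}$ for closed $F$. Let $Y$ be a compact, connected, locally connected space. A *solid partition* of $Y$ is a finite partition of $Y$ into nonempty solid sets each of which is open or closed. It is *irreducible* if, for every proper subfamily $\mathcal J$ of the family of its closed members, $Y\setminus\bigcup\mathcal J$ is connected. The *genus* of $Y$ is the maximal value (possibly $\infty$) of $n-1$, where $n$ is the number of closed members of an irreducible partition of $Y$. **Theorem.** Let $X$ be a noncompact, locally compact, connected, locally connected Hausdorff space whose one-point compactification $\hat X$ has genus $0$. Let $\nu$ be a solid-set function on $\hat X$, and put $\mu(A)=\nu(A)$ for $A\in\mathscr A_s^*(X)$. Then $\mu$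 is a solid-set function on $X$, and there is exactly one topological measure on $X$ that agrees with $\mu$ on $\mathscr A_s^*(X)$. -/

import Mathlib

open Set Topology
open scoped NNReal ENNReal

namespace TopMeas

/-- A set is bounded if its closure is compact. -/
def Bounded {X : Type*} [TopologicalSpace X] (A : Set X) : Prop :=
  IsCompact (closure A)

/-- Solid sets. The empty set counts as a connected set. In a compact space, `A` is solid if `A`
and its complement are connected; in a noncompact space, `A` is solid if `A` is connected and
every connected component of its complement is unbounded. -/
def IsSolid {X : Type*} [TopologicalSpace X] (A : Set X) : Prop :=
  IsPreconnected A ∧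
    (CompactSpace X → IsPreconnected Aᶜ) ∧
    (¬ CompactSpace X → ∀ x ∈ Aᶜ, ¬ Bounded (connectedComponentIn Aᶜ x))

/-- Compact solid sets. -/
def compactSolid (X : Type*) [TopologicalSpace X] : Set (Set X) :=
  {A | IsCompact A ∧ IsSolid A}

/-- Bounded open solid sets. -/
def openSolid (X : Type*) [TopologicalSpace X] : Set (Set X) :=
  {A | IsOpen A ∧ Bounded A ∧ IsSolid A}

/-- The domain of a solid-set function: all compact solid and all bounded open solid sets. -/
def boundedSolid (X : Type*) [TopologicalSpace X] : Set (Set X) :=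
  compactSolid X ∪ openSolid X

/-- Solid-set functions. Only the values on `boundedSolid X` matter. -/
structure IsSolidSetFunction {X : Type*} [TopologicalSpace X] (l : Set X → ℝ≥0) : Prop where
  superadditive : ∀ (n : ℕ) (K : Fin n → Set X) (C : Set X),
    (∀ i, K i ∈ compactSolid X) → C ∈ compactSolid X →
    Pairwise (fun i j => Disjoint (K i) (K j)) → (⋃ i, K i) ⊆ C →
    ∑ i, l (K i) ≤ l C
  inner_regular : ∀ U ∈ openSolid X,
    IsLUB (l '' {K | K ∈ compactSolid X ∧ K ⊆ U}) (l U)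
  outer_regular : ∀ K ∈ compactSolid X,
    IsGLB (l '' {U | U ∈ openSolid X ∧ K ⊆ U}) (l K)
  additive : ∀ (n : ℕ) (B : Fin n → Set X) (A : Set X),
    (∀ i, B i ∈ boundedSolid X) → A ∈ boundedSolid X →
    Pairwise (fun i j => Disjoint (B i) (B j)) → A = ⋃ i, B i →
    l A = ∑ i, l (B i)

/-- Topological measures. Only the values on open sets and on closed sets matter. -/
structure IsTopologicalMeasure {X : Type*} [TopologicalSpace X] (m : Set X → ℝ≥0∞) : Prop where
  not_identically_top : ∃ A : Set X, (IsOpen A ∨ IsClosed A) ∧ m A ≠ ∞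
  additive : ∀ A B : Set X, (IsCompact A ∨ IsOpen A) → (IsCompact B ∨ IsOpen B) →
    (IsCompact (A ∪ B) ∨ IsOpen (A ∪ B)) → Disjoint A B → m (A ∪ B) = m A + m B
  inner_regular : ∀ U : Set X, IsOpen U →
    m U = sSup (m '' {K | IsCompact K ∧ K ⊆ U})
  outer_regular : ∀ F : Set X, IsClosed F →
    m F = sInf (m '' {U | IsOpen U ∧ F ⊆ U})

/-- Solid partitions of the whole (compact) space: finite partitions into nonempty solid sets,
each of them open or closed. -/
structure IsSolidPartition {X : Type*} [TopologicalSpace X] (P : Set (Set X)) : Prop where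
  finite : P.Finite
  nonempty : ∀ A ∈ P, A.Nonempty
  open_or_closed : ∀ A ∈ P, IsOpen A ∨ IsClosed A
  solid : ∀ A ∈ P, IsSolid A
  disjoint : P.PairwiseDisjoint id
  covers : ⋃₀ P = univ

/-- The closed members of a partition. -/
def closedParts {X : Type*} [TopologicalSpace X] (P : Set (Set X)) : Set (Set X) :=
  {A ∈ P | IsClosed A}

/-- A solid partition is irreducible if the complement of the union of any proper subfamily of
its closed members is connected. -/
def IsIrreduciblePartition {X : Type*} [TopologicalSpace X] (P : Set (Set X)) : Prop :=
  IsSolidPartition P ∧ ∀ J : Set (Set X), J ⊂ closedParts P → IsPreconnected (⋃₀ J)ᶜ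

/-- The genus of a compact space: the largest value of `n - 1`, where `n` is the number of closed
members of an irreducible partition (`⊤` if there is no largest value). -/
noncomputable def genus (X : Type*) [TopologicalSpace X] : ℕ∞ :=
  ⨆ P ∈ {P : Set (Set X) | IsIrreduciblePartition P}, ((closedParts P).encard - 1)

/-- `m` extends the set function `l`, given on the bounded solid sets. -/
def Extends {X : Type*} [TopologicalSpace X] (m : Set X → ℝ≥0∞) (l : Set X → ℝ≥0) : Prop :=
  ∀ A ∈ boundedSolid X, m A = (l A : ℝ≥0∞)

/-- The restriction to subsets of `X` of a set function on the one-point compactification. -/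
def restrict {X : Type*} (l : Set (OnePoint X) → ℝ≥0) : Set X → ℝ≥0 :=
  fun A => l ((fun x : X => (x : OnePoint X)) '' A)

end TopMeas

set_option linter.unusedSectionVars false

/-! Everything is transported to `Y = OnePoint X`, which is compact, connected and locally
connected. There a set is solid when it and its complement are connected, and solid sets of `X`
correspond to solid sets of `Y` that miss the point at infinity.

The basic objects are carriers: complements of finitely many disjoint nonempty open solid sets.
Additivity forces the value of a carrier to be its `weight`, the total mass minus the masses of the
holes. Genus zero enters through one fact, `IsCoFamily.isPreconnected_carrier`: every carrier is
connected. Otherwise a minimal finite family of disjoint closed solid sets with disconnected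
complement, together with the components of that complement, would be an irreducible partition of
positive genus.

Since carriers are connected, a finite disjoint union of carriers inside a disjoint union of open
sets distributes over these sets. This drives `Packing.le`: the mass of such a union inside an open
solid `V` is at most `ν V`. The proof replaces carriers with several holes by solid sets until
superadditivity applies. It follows that mass is monotone, hence depends only on the set
(`HasMass.mono`). Such unions also interpolate between any closed set and any open set around it
(`exists_hasMass_between`).

On open sets the extension is the inner mass. Additivity rests on `HasMass.innerMass_le_sdiff`:
cutting a union of carriers out of an open set loses no more than its mass. This gives the modular
law for two open sets covering `Y`, so that "total mass minus inner mass of the complement" is a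
consistent value on compact sets, and all cases of additivity follow.

For uniqueness, additivity fixes every topological measure extending the data on carriers that miss
infinity. Interpolation and inner regularity then fix it on open sets, and outer regularity on
closed sets. -/

namespace TopMeas

/-! ### Components of open sets in locally connected spaces -/

section Components

variable {Y : Type*} [TopologicalSpace Y]

theorem closure_component_inter_subset (W : Set Y) (x : Y) :
    closure (connectedComponentIn W x) ∩ W ⊆ connectedComponentIn W x := by
  by_cases hx : x ∈ W
  · have h1 : connectedComponentIn W x ⊆ closure (connectedComponentIn W x) ∩ W :=
      subset_inter subset_closure (connectedComponentIn_subset W x)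
    exact (isPreconnected_connectedComponentIn.subset_closure h1
      inter_subset_left).subset_connectedComponentIn (h1 (mem_connectedComponentIn hx))
      inter_subset_right
  · simp [connectedComponentIn_eq_empty hx]

theorem isClosed_sUnion_of_finite {𝓒 : Set (Set Y)} (h : 𝓒.Finite) (hc : ∀ C ∈ 𝓒, IsClosed C) :
    IsClosed (⋃₀ 𝓒) := by
  rw [sUnion_eq_biUnion]
  exact h.isClosed_biUnion hc

theorem component_eq_or_disjoint (W : Set Y) (x y : Y) :
    connectedComponentIn W x = connectedComponentIn W y ∨
      Disjoint (connectedComponentIn W x) (connectedComponentIn W y) := by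
  by_cases h : Disjoint (connectedComponentIn W x) (connectedComponentIn W y)
  · exact Or.inr h
  · obtain ⟨z, hz1, hz2⟩ := Set.not_disjoint_iff.1 h
    exact Or.inl ((connectedComponentIn_eq hz1).trans (connectedComponentIn_eq hz2).symm)

theorem isPreconnected_union_of_closure {A B : Set Y} (hA : IsPreconnected A)
    (hB : IsPreconnected B) (h : (closure A ∩ B).Nonempty) : IsPreconnected (A ∪ B) := by
  obtain ⟨b, hb1, hb2⟩ := h
  have h1 : IsPreconnected (insert b A) :=
    hA.subset_closure (subset_insert _ _) (insert_subset hb1 subset_closure)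
  have h2 := IsPreconnected.union b (mem_insert b A) hb2 h1 hB
  rwa [insert_union, insert_eq_of_mem (mem_union_right A hb2)] at h2

/-- Sets that are connected and have a connected complement. -/
def Biconnected {Y : Type*} [TopologicalSpace Y] (A : Set Y) : Prop :=
  IsPreconnected A ∧ IsPreconnected Aᶜ

theorem Biconnected.compl {A : Set Y} (h : Biconnected A) : Biconnected Aᶜ :=
  ⟨h.2, by rw [compl_compl]; exact h.1⟩

theorem isSolid_iff_biconnected [CompactSpace Y] {A : Set Y} : IsSolid A ↔ Biconnected A :=
  ⟨fun h => ⟨h.1, h.2.1 ‹_›⟩, fun h => ⟨h.1, fun _ => h.2, fun h' => absurd ‹_› h'⟩⟩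

variable [LocallyConnectedSpace Y]

/-- The component is open by local connectedness, and the hypothesis on its closure makes it
relatively closed in `T`. -/
theorem subset_component_of_isPreconnected {W T : Set Y} (hW : IsOpen W) (hT : IsPreconnected T)
    {x : Y} (hx : x ∈ W) (hWT : W ⊆ T) (h : closure (connectedComponentIn W x) ∩ T ⊆ W) :
    T ⊆ connectedComponentIn W x :=
  hT.subset_of_closure_inter_subset hW.connectedComponentIn
    ⟨x, hWT hx, mem_connectedComponentIn hx⟩
    fun _ hz => closure_component_inter_subset W x ⟨hz.1, h hz⟩

theorem finite_components_meeting {W K : Set Y} (hW : IsOpen W) (hK : IsCompact K) (hKW : K ⊆ W) :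
    {V | ∃ x ∈ K, V = connectedComponentIn W x}.Finite := by
  obtain ⟨t, htK⟩ := hK.elim_nhds_subcover' (fun x _ => connectedComponentIn W x)
    (fun x hx => hW.connectedComponentIn.mem_nhds (mem_connectedComponentIn (hKW hx)))
  refine (Set.Finite.image (fun x : K => connectedComponentIn W (x : Y)) t.finite_toSet).subset ?_
  rintro V ⟨x, hx, rfl⟩
  have hx' := htK hx
  simp only [mem_iUnion] at hx'
  obtain ⟨y, hy, hxy⟩ := hx'
  exact ⟨y, hy, connectedComponentIn_eq hxy⟩

/-- If the union of a finite disjoint family of at least two closed sets disconnects the space but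
no union of a proper subfamily does, then every component of the complement accumulates at every
member of the family. -/
theorem closure_component_meets_of_minimal {𝓒 : Set (Set Y)} (hfin : 𝓒.Finite)
    (hcl : ∀ C ∈ 𝓒, IsClosed C) (hne : ∀ C ∈ 𝓒, C.Nonempty) (hdisj : 𝓒.PairwiseDisjoint id)
    (hmin : ∀ J, J ⊂ 𝓒 → IsPreconnected (⋃₀ J)ᶜ) {x : Y} (hx : x ∈ (⋃₀ 𝓒)ᶜ)
    {C : Set Y} (hC : C ∈ 𝓒) :
    (closure (connectedComponentIn (⋃₀ 𝓒)ᶜ x) ∩ C).Nonempty := by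
  by_contra h
  rw [not_nonempty_iff_eq_empty] at h
  have hJ : 𝓒 \ {C} ⊂ 𝓒 := ⟨sdiff_subset, fun h' => (h' hC).2 rfl⟩
  -- The complement of the other members is connected by minimality and contains `C`. A component
  -- not accumulating at `C` would swallow it, hence also `C`.
  have := subset_component_of_isPreconnected (isClosed_sUnion_of_finite hfin hcl).isOpen_compl (hmin _ hJ) hx
    (compl_subset_compl.2 (sUnion_subset_sUnion sdiff_subset)) ?_
  · obtain ⟨c, hc⟩ := hne C hC
    refine connectedComponentIn_subset _ _ (this ?_) ⟨C, hC, hc⟩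
    rintro ⟨D, ⟨hD, hDC⟩, hcD⟩
    exact Set.disjoint_left.1 (hdisj hD hC hDC) hcD hc
  · rintro z ⟨hz1, hz2⟩ ⟨D, hD, hzD⟩
    by_cases hDC : D = C
    · subst hDC
      exact (h ▸ (⟨hz1, hzD⟩ : z ∈ _ ∩ D) : z ∈ (∅ : Set Y))
    · exact hz2 ⟨D, ⟨hD, hDC⟩, hzD⟩

variable [ConnectedSpace Y]

theorem closure_component_compl_meets {C : Set Y} (hC : IsClosed C) (hne : C.Nonempty) {x : Y}
    (hx : x ∉ C) : (closure (connectedComponentIn Cᶜ x) ∩ C).Nonempty := by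
  by_contra h
  rw [not_nonempty_iff_eq_empty] at h
  have := subset_component_of_isPreconnected hC.isOpen_compl isPreconnected_univ hx
    (subset_univ _) (fun z hz hzC => (h ▸ (⟨hz.1, hzC⟩ : z ∈ _ ∩ C) : z ∈ (∅ : Set Y)))
  obtain ⟨c, hc⟩ := hne
  exact connectedComponentIn_subset _ _ (this (mem_univ c)) hc

/-- The complement consists of `C` and the other components, each of which accumulates at `C`. This
is the source of open solid sets: all complementary components of a connected closed set are
biconnected. -/
theorem isPreconnected_compl_component_compl {C : Set Y} (hC : IsClosed C) (hne : C.Nonempty)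
    (hCc : IsPreconnected C) (x : Y) : IsPreconnected (connectedComponentIn Cᶜ x)ᶜ := by
  obtain ⟨c, hc⟩ := hne
  have hsub : C ⊆ (connectedComponentIn Cᶜ x)ᶜ := fun z hz hz' =>
    connectedComponentIn_subset _ _ hz' hz
  refine isPreconnected_of_forall c fun y hy => ?_
  by_cases hyC : y ∈ C
  · exact ⟨C, hsub, hc, hyC, hCc⟩
  · refine ⟨connectedComponentIn Cᶜ y ∪ C, union_subset ?_ hsub, Or.inr hc,
      Or.inl (mem_connectedComponentIn hyC), isPreconnected_union_of_closure
      isPreconnected_connectedComponentIn hCc (closure_component_compl_meets hC ⟨c, hc⟩ hyC)⟩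
    rcases component_eq_or_disjoint Cᶜ y x with h | h
    · exact absurd (h ▸ mem_connectedComponentIn hyC) hy
    · exact h.subset_compl_right

end Components

/-! ### Interpolation by connected and biconnected sets -/

section Separation

variable {Y : Type*} [TopologicalSpace Y] [T2Space Y] [CompactSpace Y]

variable [LocallyConnectedSpace Y]

theorem exists_connected_closed_nhd {V : Set Y} (hV : IsOpen V) {x : Y} (hx : x ∈ V) :
    ∃ D, IsClosed D ∧ IsPreconnected D ∧ x ∈ interior D ∧ D ⊆ V := by
  obtain ⟨N, hN, hNc, hNV⟩ := exists_mem_nhds_isClosed_subset (hV.mem_nhds hx)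
  have hxN : x ∈ interior N := mem_interior_iff_mem_nhds.2 hN
  refine ⟨closure (connectedComponentIn (interior N) x), isClosed_closure,
    isPreconnected_connectedComponentIn.closure, ?_, ?_⟩
  · exact interior_maximal subset_closure isOpen_interior.connectedComponentIn
      (mem_connectedComponentIn hxN)
  · exact (closure_minimal ((connectedComponentIn_subset _ _).trans interior_subset) hNc).trans hNV

/-- The points that a closed connected subset of `V` joins to `a`, with the point in its interior,
form an open and relatively closed subset of `V`, hence all of `V`. Compactness of `K` then needs
only finitely many such sets, all sharing `a`. -/
theorem exists_connected_closed_between {V K : Set Y} (hV : IsOpen V) (hVc : IsPreconnected V)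
    (hK : IsClosed K) (hKV : K ⊆ V) :
    ∃ D, IsClosed D ∧ IsPreconnected D ∧ K ⊆ interior D ∧ D ⊆ V := by
  rcases V.eq_empty_or_nonempty with rfl | ⟨a, ha⟩
  · exact ⟨∅, isClosed_empty, isPreconnected_empty, hKV.trans (empty_subset _), Subset.rfl⟩
  let A : Set Y := {x | ∃ D, IsClosed D ∧ IsPreconnected D ∧ a ∈ D ∧ x ∈ interior D ∧ D ⊆ V}
  have hA : IsOpen A := by
    rw [isOpen_iff_mem_nhds]
    rintro x ⟨D, h1, h2, h3, h4, h5⟩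
    exact Filter.mem_of_superset (isOpen_interior.mem_nhds h4) fun y hy => ⟨D, h1, h2, h3, hy, h5⟩
  have hVA : V ⊆ A := by
    refine hVc.subset_of_closure_inter_subset hA ?_ ?_
    · obtain ⟨D, h1, h2, h3, h4⟩ := exists_connected_closed_nhd hV ha
      exact ⟨a, ha, D, h1, h2, interior_subset h3, h3, h4⟩
    · rintro x ⟨hx1, hx2⟩
      obtain ⟨D, h1, h2, h3, h4⟩ := exists_connected_closed_nhd hV hx2
      obtain ⟨y, hy, E, e1, e2, e3, e4, e5⟩ := mem_closure_iff.1 hx1 _ isOpen_interior h3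
      exact ⟨D ∪ E, h1.union e1, h2.union' ⟨y, interior_subset hy, interior_subset e4⟩ e2,
        Or.inr e3, interior_mono subset_union_left h3, union_subset h4 e5⟩
  suffices h : ∃ D, IsClosed D ∧ IsPreconnected D ∧ a ∈ D ∧ K ⊆ interior D ∧ D ⊆ V by
    obtain ⟨D, h1, h2, -, h4, h5⟩ := h
    exact ⟨D, h1, h2, h4, h5⟩
  refine hK.isCompact.induction_on (p := fun K => ∃ D, IsClosed D ∧ IsPreconnected D ∧ a ∈ D ∧
    K ⊆ interior D ∧ D ⊆ V) ?_ ?_ ?_ ?_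
  · exact ⟨{a}, isClosed_singleton, isPreconnected_singleton, rfl, empty_subset _,
      singleton_subset_iff.2 ha⟩
  · rintro s t hst ⟨D, h1, h2, h3, h4, h5⟩
    exact ⟨D, h1, h2, h3, hst.trans h4, h5⟩
  · rintro s t ⟨D, h1, h2, h3, h4, h5⟩ ⟨E, e1, e2, e3, e4, e5⟩
    exact ⟨D ∪ E, h1.union e1, h2.union' ⟨a, h3, e3⟩ e2, Or.inl h3,
      union_subset (h4.trans (interior_mono subset_union_left))
        (e4.trans (interior_mono subset_union_right)), union_subset h5 e5⟩
  · intro x hx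
    obtain ⟨D, h1, h2, h3, h4, h5⟩ := hVA (hKV hx)
    exact ⟨interior D, mem_nhdsWithin_of_mem_nhds (isOpen_interior.mem_nhds h4), D, h1, h2, h3,
      Subset.rfl, h5⟩

variable [ConnectedSpace Y]

/-- Fill the holes of a connected interpolating set `D`: the connected set `Vᶜ` lies in a single
component of `Dᶜ`, and the complement of that component stays inside `V`. -/
theorem exists_closed_biconnected_between {V K : Set Y} (hV : IsOpen V) (hVb : Biconnected V)
    (hK : IsClosed K) (hKV : K ⊆ V) :
    ∃ C, IsClosed C ∧ Biconnected C ∧ K ⊆ interior C ∧ C ⊆ V := by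
  obtain ⟨D, h1, h2, h3, h4⟩ := exists_connected_closed_between hV hVb.1 hK hKV
  rcases D.eq_empty_or_nonempty with rfl | hne
  · exact ⟨∅, h1, ⟨h2, by simpa using isPreconnected_univ⟩, h3, h4⟩
  rcases Vᶜ.eq_empty_or_nonempty with hVe | ⟨x, hx⟩
  · have : V = univ := compl_empty_iff.1 hVe
    subst this
    exact ⟨univ, isClosed_univ, ⟨isPreconnected_univ, by simpa using isPreconnected_empty⟩,
      by simp, Subset.rfl⟩
  · have hxD : x ∈ Dᶜ := fun h => hx (h4 h)
    have hDsub : D ⊆ (connectedComponentIn Dᶜ x)ᶜ := fun z hz hz' =>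
      connectedComponentIn_subset _ _ hz' hz
    refine ⟨(connectedComponentIn Dᶜ x)ᶜ, h1.isOpen_compl.connectedComponentIn.isClosed_compl,
      ⟨isPreconnected_compl_component_compl h1 hne h2 x, ?_⟩, h3.trans (interior_mono hDsub), ?_⟩
    · rw [compl_compl]; exact isPreconnected_connectedComponentIn
    · exact compl_subset_comm.1
        (hVb.2.subset_connectedComponentIn hx (compl_subset_compl.2 h4))

theorem exists_open_biconnected_between {D O : Set Y} (hD : IsClosed D) (hDb : Biconnected D)
    (hO : IsOpen O) (hDO : D ⊆ O) :
    ∃ V, IsOpen V ∧ Biconnected V ∧ D ⊆ V ∧ closure V ⊆ O := by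
  obtain ⟨C, h1, h2, h3, h4⟩ := exists_closed_biconnected_between hD.isOpen_compl hDb.compl
    hO.isClosed_compl (compl_subset_compl.2 hDO)
  refine ⟨Cᶜ, h1.isOpen_compl, h2.compl, subset_compl_comm.1 h4, ?_⟩
  rw [closure_compl]
  exact compl_subset_comm.1 h3

end Separation

/-! ### Genus zero: complements of finite disjoint families of solid sets are connected -/

section Genus

variable {Y : Type*} [TopologicalSpace Y] [T2Space Y] [CompactSpace Y] [LocallyConnectedSpace Y]
  [ConnectedSpace Y]

/-- The partition consists of the family and the components of its complement. By minimality every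
component accumulates at every member, which makes the components finite in number and biconnected.
-/
theorem exists_irreducible_of_minimal {𝓒 : Set (Set Y)} (hfin : 𝓒.Finite)
    (hcl : ∀ C ∈ 𝓒, IsClosed C) (hne : ∀ C ∈ 𝓒, C.Nonempty) (hb : ∀ C ∈ 𝓒, Biconnected C)
    (hdisj : 𝓒.PairwiseDisjoint id) (hmin : ∀ J, J ⊂ 𝓒 → IsPreconnected (⋃₀ J)ᶜ)
    (hcard : 𝓒.Nontrivial) (hdc : ¬ IsPreconnected (⋃₀ 𝓒)ᶜ) :
    ∃ P : Set (Set Y), IsIrreduciblePartition P ∧ closedParts P = 𝓒 := by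
  set W := (⋃₀ 𝓒)ᶜ with hW
  have hWo : IsOpen W := (isClosed_sUnion_of_finite hfin hcl).isOpen_compl
  obtain ⟨C₁, hC₁, C₂, hC₂, hC₁₂⟩ := hcard
  have hmeet : ∀ x ∈ W, ∀ C ∈ 𝓒, (closure (connectedComponentIn W x) ∩ C).Nonempty :=
    fun x hx C hC => closure_component_meets_of_minimal hfin hcl hne hdisj hmin hx hC
  let 𝓦 : Set (Set Y) := {V | ∃ x ∈ W, V = connectedComponentIn W x}
  have hWfin : 𝓦.Finite := by
    have hcl' : IsClosed (⋃₀ (𝓒 \ {C₁})) :=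
      isClosed_sUnion_of_finite (hfin.subset sdiff_subset) fun C hC => hcl C hC.1
    have hsub : C₁ ⊆ (⋃₀ (𝓒 \ {C₁}))ᶜ := by
      rintro c hc ⟨D, ⟨hD, hDC⟩, hcD⟩
      exact Set.disjoint_left.1 (hdisj hD hC₁ hDC) hcD hc
    -- Every component accumulates at `C₁`, inside `U`, and at `C₂`, outside `closure U`. So it
    -- meets `frontier U`, a compact subset of `W`, and only finitely many components can do that.
    obtain ⟨U, hUo, hCU, hUc⟩ := normal_exists_closure_subset (hcl C₁ hC₁) hcl'.isOpen_compl hsub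
    have hfr : frontier U ⊆ W := by
      rintro z hz ⟨D, hD, hzD⟩
      by_cases hDC : D = C₁
      · subst hDC
        exact (hUo.frontier_eq ▸ hz : z ∈ closure U \ U).2 (hCU hzD)
      · exact hUc (frontier_subset_closure hz) ⟨D, ⟨hD, hDC⟩, hzD⟩
    refine (finite_components_meeting hWo isClosed_frontier.isCompact hfr).subset ?_
    rintro V ⟨x, hx, rfl⟩
    by_contra hno
    have hdisjf : Disjoint (connectedComponentIn W x) (frontier U) := by
      rw [Set.disjoint_left]
      exact fun z hz hzf => hno ⟨z, hzf, connectedComponentIn_eq hz⟩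
    obtain ⟨c, hc, hcC⟩ := hmeet x hx C₁ hC₁
    obtain ⟨u, huU, hu⟩ := mem_closure_iff.1 hc U hUo (hCU hcC)
    have hsubU : connectedComponentIn W x ⊆ U := by
      refine isPreconnected_connectedComponentIn.subset_of_closure_inter_subset hUo ⟨u, hu, huU⟩ ?_
      rintro z ⟨hz1, hz2⟩
      by_contra hzU
      exact Set.disjoint_left.1 hdisjf hz2 (hUo.frontier_eq ▸ ⟨hz1, hzU⟩)
    obtain ⟨d, hd, hdC⟩ := hmeet x hx C₂ hC₂
    exact hUc (closure_mono hsubU hd) ⟨C₂, ⟨hC₂, hC₁₂.symm⟩, hdC⟩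
  have hVW : ∀ V ∈ 𝓦, V ⊆ W := by
    rintro V ⟨x, hx, rfl⟩; exact connectedComponentIn_subset _ _
  have hWo' : ∀ V ∈ 𝓦, IsOpen V := by
    rintro V ⟨x, hx, rfl⟩; exact hWo.connectedComponentIn
  have hWne : ∀ V ∈ 𝓦, V.Nonempty := by
    rintro V ⟨x, hx, rfl⟩; exact ⟨x, mem_connectedComponentIn hx⟩
  have hCW : ∀ C ∈ 𝓒, Disjoint C W := fun C hC =>
    Set.disjoint_left.2 fun z hz hzW => hzW ⟨C, hC, hz⟩
  have hWb : ∀ V ∈ 𝓦, Biconnected V := by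
    rintro V ⟨x, hx, rfl⟩
    refine ⟨isPreconnected_connectedComponentIn, ?_⟩
    -- A second component serves as a hub: it joins to every member of the family, and through `C₁`
    -- to every other component.
    obtain ⟨x', hx', hxx'⟩ : ∃ x' ∈ W, x' ∉ connectedComponentIn W x := by
      by_contra! h
      exact hdc (Subset.antisymm (connectedComponentIn_subset W x) h ▸
        isPreconnected_connectedComponentIn)
    have hcomp : ∀ y ∈ W, y ∉ connectedComponentIn W x →
        connectedComponentIn W y ⊆ (connectedComponentIn W x)ᶜ := by
      intro y hy hyx
      rcases component_eq_or_disjoint W y x with h | h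
      · exact absurd (h ▸ mem_connectedComponentIn hy) hyx
      · exact h.subset_compl_right
    have hCsub : ∀ C ∈ 𝓒, C ⊆ (connectedComponentIn W x)ᶜ := fun C hC z hz hz' =>
      Set.disjoint_left.1 (hCW C hC) hz (connectedComponentIn_subset _ _ hz')
    have hunion : ∀ y ∈ W, ∀ C ∈ 𝓒, IsPreconnected (connectedComponentIn W y ∪ C) :=
      fun y hy C hC => isPreconnected_union_of_closure isPreconnected_connectedComponentIn
        (hb C hC).1 (hmeet y hy C hC)
    refine isPreconnected_of_forall x' fun y hy => ?_
    by_cases hyW : y ∈ W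
    · obtain ⟨c, hc⟩ := hne C₁ hC₁
      exact ⟨(connectedComponentIn W x' ∪ C₁) ∪ (connectedComponentIn W y ∪ C₁),
        union_subset (union_subset (hcomp x' hx' hxx') (hCsub _ hC₁))
          (union_subset (hcomp y hyW hy) (hCsub _ hC₁)),
        Or.inl (Or.inl (mem_connectedComponentIn hx')),
        Or.inr (Or.inl (mem_connectedComponentIn hyW)),
        (hunion x' hx' _ hC₁).union' ⟨c, Or.inr hc, Or.inr hc⟩ (hunion y hyW _ hC₁)⟩
    · obtain ⟨C, hC, hyC⟩ := not_not.1 hyW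
      exact ⟨connectedComponentIn W x' ∪ C, union_subset (hcomp x' hx' hxx') (hCsub C hC),
        Or.inl (mem_connectedComponentIn hx'), Or.inr hyC, hunion x' hx' C hC⟩
  have hparts : closedParts (𝓒 ∪ 𝓦) = 𝓒 := by
    refine Subset.antisymm ?_ fun C hC => ⟨Or.inl hC, hcl C hC⟩
    rintro V ⟨hV | hV, hVc⟩
    · exact hV
    · have hu : V = univ := IsClopen.eq_univ ⟨hVc, hWo' V hV⟩ (hWne V hV)
      obtain ⟨c, hc⟩ := hne C₁ hC₁
      exact absurd (hVW V hV (hu ▸ mem_univ c)) (Set.disjoint_left.1 (hCW _ hC₁) hc)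
  refine ⟨𝓒 ∪ 𝓦, ⟨⟨hfin.union hWfin, ?_, ?_, ?_, ?_, ?_⟩, ?_⟩, hparts⟩
  · rintro A (hA | hA)
    exacts [hne A hA, hWne A hA]
  · rintro A (hA | hA)
    exacts [Or.inr (hcl A hA), Or.inl (hWo' A hA)]
  · rintro A (hA | hA)
    exacts [isSolid_iff_biconnected.2 (hb A hA), isSolid_iff_biconnected.2 (hWb A hA)]
  · rintro A (hA | hA) B (hB | hB) hAB
    · exact hdisj hA hB hAB
    · exact (hCW A hA).mono_right (hVW B hB)
    · exact ((hCW B hB).mono_right (hVW A hA)).symm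
    · obtain ⟨x, hx, rfl⟩ := hA
      obtain ⟨y, hy, rfl⟩ := hB
      exact (component_eq_or_disjoint W x y).resolve_left hAB
  · rw [eq_univ_iff_forall]
    intro y
    by_cases hy : y ∈ W
    · exact ⟨_, Or.inr ⟨y, hy, rfl⟩, mem_connectedComponentIn hy⟩
    · obtain ⟨C, hC, hyC⟩ := not_not.1 hy
      exact ⟨C, Or.inl hC, hyC⟩
  · intro J hJ
    rw [hparts] at hJ
    exact hmin J hJ

/-- By strong induction a counterexample would be a minimal disconnecting family with at least two
members, and such a family yields an irreducible partition of positive genus. -/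
theorem isPreconnected_compl_sUnion_closed (hg : genus Y = 0) (n : ℕ) :
    ∀ 𝓒 : Set (Set Y), 𝓒.Finite → 𝓒.ncard = n → (∀ C ∈ 𝓒, IsClosed C) → (∀ C ∈ 𝓒, C.Nonempty) →
      (∀ C ∈ 𝓒, Biconnected C) → 𝓒.PairwiseDisjoint id → IsPreconnected (⋃₀ 𝓒)ᶜ := by
  induction n using Nat.strong_induction_on with
  | _ n ih =>
  intro 𝓒 hfin hn hcl hne hb hdisj
  have hmin : ∀ J, J ⊂ 𝓒 → IsPreconnected (⋃₀ J)ᶜ := fun J hJ =>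
    ih _ (hn ▸ Set.ncard_lt_ncard hJ hfin) J (hfin.subset hJ.1) rfl
      (fun C hC => hcl C (hJ.1 hC)) (fun C hC => hne C (hJ.1 hC)) (fun C hC => hb C (hJ.1 hC))
      (hdisj.subset hJ.1)
  rcases 𝓒.subsingleton_or_nontrivial with hs | hs
  · rcases hs.eq_empty_or_singleton with rfl | ⟨C, rfl⟩
    · simpa using isPreconnected_univ
    · simpa using (hb C rfl).2
  · by_contra hdc
    obtain ⟨P, hP, hPC⟩ := exists_irreducible_of_minimal hfin hcl hne hb hdisj hmin hs hdc
    have h1 : (closedParts P).encard - 1 ≤ 0 := by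
      rw [← hg]
      exact le_iSup₂_of_le (f := fun (P : Set (Set Y)) (_ : P ∈ {P : Set (Set Y) |
        IsIrreduciblePartition P}) => (closedParts P).encard - 1) P hP le_rfl
    rw [hPC] at h1
    exact absurd (Set.one_lt_encard_iff_nontrivial.2 hs)
      (not_lt.2 (tsub_eq_zero_iff_le.1 (nonpos_iff_eq_zero.1 h1)))

/-- A separation of the complement extends to disjoint open sets `U` and `W`. Shrinking each `V` to
a closed biconnected set that still covers the part of `V` outside `U ∪ W` carries the separation
over to the closed case. -/
theorem isPreconnected_compl_sUnion_open (hg : genus Y = 0) (𝓥 : Finset (Set Y))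
    (ho : ∀ V ∈ 𝓥, IsOpen V) (hb : ∀ V ∈ 𝓥, Biconnected V)
    (hdisj : (𝓥 : Set (Set Y)).PairwiseDisjoint id) :
    IsPreconnected (⋃₀ (𝓥 : Set (Set Y)))ᶜ := by
  have hFc : IsClosed (⋃₀ (𝓥 : Set (Set Y)))ᶜ := (isOpen_sUnion ho).isClosed_compl
  rw [isPreconnected_iff_subset_of_fully_disjoint_closed hFc]
  intro u v hu hv hsub huv
  obtain ⟨U, W, hU, hW, huU, hvW, hUW⟩ := normal_separation hu hv huv
  have hK : ∀ V : Set Y, V ∈ 𝓥 → ∃ C, IsClosed C ∧ Biconnected C ∧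
      (U ∪ W)ᶜ ∩ (⋃₀ ((𝓥 : Set (Set Y)) \ {V}))ᶜ ⊆ C ∧ C ⊆ V := by
    intro V hV
    have hKV : (U ∪ W)ᶜ ∩ (⋃₀ ((𝓥 : Set (Set Y)) \ {V}))ᶜ ⊆ V := by
      rintro z ⟨hz1, hz2⟩
      by_contra hzV
      refine hz1 ((hsub ?_).imp (fun h => huU h) (fun h => hvW h))
      rintro ⟨A, hA, hzA⟩
      exact hz2 ⟨A, ⟨hA, fun h => hzV (h ▸ hzA)⟩, hzA⟩
    obtain ⟨C, h1, h2, h3, h4⟩ := exists_closed_biconnected_between (ho V hV) (hb V hV)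
      ((hU.union hW).isClosed_compl.inter (isOpen_sUnion fun A hA => ho A hA.1).isClosed_compl) hKV
    exact ⟨C, h1, h2, h3.trans interior_subset, h4⟩
  choose! C hCc hCb hCK hCV using hK
  -- Empty shrunken sets are dropped, because the closed case requires nonempty members.
  have hpre : IsPreconnected (⋃₀ ((C '' 𝓥) \ {∅}))ᶜ := by
    refine isPreconnected_compl_sUnion_closed hg _ _ ((𝓥.finite_toSet.image C).subset sdiff_subset)
      rfl ?_ ?_ ?_ ?_
    · rintro _ ⟨⟨V, hV, rfl⟩, -⟩
      exact hCc V hV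
    · rintro _ ⟨⟨V, hV, rfl⟩, h⟩
      exact nonempty_iff_ne_empty.2 h
    · rintro _ ⟨⟨V, hV, rfl⟩, -⟩
      exact hCb V hV
    · rintro _ ⟨⟨V, hV, rfl⟩, -⟩ _ ⟨⟨V', hV', rfl⟩, -⟩ hne
      exact (hdisj hV hV' (fun h => hne (h ▸ rfl))).mono (hCV V hV) (hCV V' hV')
  have hFsub : (⋃₀ (𝓥 : Set (Set Y)))ᶜ ⊆ (⋃₀ ((C '' 𝓥) \ {∅}))ᶜ := by
    rintro z hz ⟨_, ⟨⟨V, hV, rfl⟩, -⟩, hzV⟩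
    exact hz ⟨V, hV, hCV V hV hzV⟩
  have hcov : (⋃₀ ((C '' 𝓥) \ {∅}))ᶜ ⊆ U ∪ W := by
    intro z hz
    by_contra hzUW
    by_cases hzV : z ∈ ⋃₀ (𝓥 : Set (Set Y))
    · obtain ⟨V, hV, hzV⟩ := hzV
      have hzC : z ∈ C V := by
        refine hCK V hV ⟨hzUW, ?_⟩
        rintro ⟨A, ⟨hA, hAV⟩, hzA⟩
        exact Set.disjoint_left.1 (hdisj hA hV hAV) hzA hzV
      exact hz ⟨C V, ⟨⟨V, hV, rfl⟩, Set.Nonempty.ne_empty ⟨z, hzC⟩⟩, hzC⟩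
    · exact hzUW ((hsub hzV).imp (fun h => huU h) (fun h => hvW h))
  refine (hpre.subset_or_subset hU hW hUW hcov).imp (fun h z hz => ?_) fun h z hz => ?_
  · exact (hsub hz).resolve_right fun hzv =>
      Set.disjoint_left.1 hUW (h (hFsub hz)) (hvW hzv)
  · exact (hsub hz).resolve_left fun hzu =>
      Set.disjoint_left.1 hUW (huU hzu) (h (hFsub hz))

end Genus

/-! ### Carriers, packings and their masses -/

section Packing

variable {Y : Type*} [TopologicalSpace Y]

/-- A finite disjoint family of nonempty open sets that are connected and have connected
complements. -/
structure IsCoFamily (𝓥 : Finset (Set Y)) : Prop where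
  isOpen : ∀ V ∈ 𝓥, IsOpen V
  biconnected : ∀ V ∈ 𝓥, Biconnected V
  nonempty : ∀ V ∈ 𝓥, V.Nonempty
  disjoint : (𝓥 : Set (Set Y)).PairwiseDisjoint id

/-- The complement of the union of a finite family of sets. -/
def carrier {α : Type*} (𝓥 : Finset (Set α)) : Set α := (⋃₀ (𝓥 : Set (Set α)))ᶜ

/-- The mass that a solid-set function should give to `carrier 𝓥`. -/
noncomputable def weight (ν : Set Y → ℝ≥0) (𝓥 : Finset (Set Y)) : ℝ :=
  (ν univ : ℝ) - ∑ V ∈ 𝓥, (ν V : ℝ)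

/-- `Packing ν K r n`: the set `K` is a finite disjoint union of carriers whose weights add up to
`r`; the number `n` is zero if each of the carriers has a connected complement. -/
inductive Packing (ν : Set Y → ℝ≥0) : Set Y → ℝ → ℕ → Prop
  | empty : Packing ν ∅ 0 0
  | cons {𝓥 : Finset (Set Y)} {K : Set Y} {r : ℝ} {n : ℕ} : IsCoFamily 𝓥 →
      Disjoint (carrier 𝓥) K → Packing ν K r n →
      Packing ν (carrier 𝓥 ∪ K) (weight ν 𝓥 + r) (𝓥.card - 1 + n)

/-- The set `K` is a finite disjoint union of carriers whose weights add up to `r`. -/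
def HasMass (ν : Set Y → ℝ≥0) (K : Set Y) (r : ℝ) : Prop := ∃ n, Packing ν K r n

/-- The supremum of the masses of the finite disjoint unions of carriers inside `U`. -/
noncomputable def innerMass (ν : Set Y → ℝ≥0) (U : Set Y) : ℝ :=
  sSup {r | ∃ K, K ⊆ U ∧ HasMass ν K r}

variable {ν : Set Y → ℝ≥0}

theorem mem_carrier {α : Type*} {𝓥 : Finset (Set α)} {y : α} : y ∈ carrier 𝓥 ↔ ∀ V ∈ 𝓥, y ∉ V := by
  simp [carrier]

theorem IsCoFamily.isClosed {𝓥 : Finset (Set Y)} (h : IsCoFamily 𝓥) : IsClosed (carrier 𝓥) :=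
  (isOpen_sUnion h.isOpen).isClosed_compl

theorem Packing.isClosed {K : Set Y} {r : ℝ} {n : ℕ} (h : Packing ν K r n) : IsClosed K := by
  induction h with
  | empty => exact isClosed_empty
  | cons h1 _ _ ih => exact h1.isClosed.union ih

theorem HasMass.isClosed {K : Set Y} {r : ℝ} (h : HasMass ν K r) : IsClosed K :=
  h.elim fun _ h => h.isClosed

theorem Packing.single {𝓥 : Finset (Set Y)} (h : IsCoFamily 𝓥) :
    Packing ν (carrier 𝓥) (weight ν 𝓥) (𝓥.card - 1) := by
  simpa using Packing.cons (ν := ν) h (disjoint_empty _) Packing.empty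

theorem Packing.union {K K' : Set Y} {r r' : ℝ} {n n' : ℕ} (h : Packing ν K r n)
    (h' : Packing ν K' r' n') (hd : Disjoint K K') : Packing ν (K ∪ K') (r + r') (n + n') := by
  induction h with
  | empty => simpa using h'
  | cons h1 h2 h3 ih =>
    rw [disjoint_union_left] at hd
    rw [union_assoc, add_assoc, add_assoc]
    exact Packing.cons h1 (h2.union_right hd.1) (ih hd.2)

theorem HasMass.union {K K' : Set Y} {r r' : ℝ} (h : HasMass ν K r) (h' : HasMass ν K' r')
    (hd : Disjoint K K') : HasMass ν (K ∪ K') (r + r') := by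
  obtain ⟨n, h⟩ := h
  obtain ⟨n', h'⟩ := h'
  exact ⟨_, h.union h' hd⟩

theorem HasMass.empty : HasMass ν ∅ 0 := ⟨0, Packing.empty⟩

theorem HasMass.single {𝓥 : Finset (Set Y)} (h : IsCoFamily 𝓥) :
    HasMass ν (carrier 𝓥) (weight ν 𝓥) := ⟨_, Packing.single h⟩

/-- A preconnected subset of a disjoint union of open sets lies in one of them. -/
theorem exists_subset_of_isPreconnected {𝓥 : Finset (Set Y)} (ho : ∀ V ∈ 𝓥, IsOpen V)
    (hd : (𝓥 : Set (Set Y)).PairwiseDisjoint id) (hne : 𝓥.Nonempty) {T : Set Y}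
    (hT : IsPreconnected T) (h : T ⊆ ⋃₀ (𝓥 : Set (Set Y))) : ∃ V ∈ 𝓥, T ⊆ V := by
  rcases T.eq_empty_or_nonempty with rfl | ⟨x, hx⟩
  · obtain ⟨V, hV⟩ := hne
    exact ⟨V, hV, empty_subset _⟩
  · obtain ⟨V, hV, hxV⟩ := h hx
    refine ⟨V, hV, hT.subset_left_of_subset_union (ho V hV)
      (isOpen_sUnion (s := (𝓥 : Set (Set Y)) \ {V}) fun A hA => ho A hA.1) ?_ ?_ ⟨x, hx, hxV⟩⟩
    · rw [Set.disjoint_left]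
      rintro z hz ⟨A, ⟨hA, hAV⟩, hzA⟩
      exact Set.disjoint_left.1 (hd hA hV hAV) hzA hz
    · intro z hz
      obtain ⟨A, hA, hzA⟩ := h hz
      by_cases hAV : A = V
      · exact Or.inl (hAV ▸ hzA)
      · exact Or.inr ⟨A, ⟨hA, hAV⟩, hzA⟩

theorem biconnected_univ [ConnectedSpace Y] : Biconnected (univ : Set Y) :=
  ⟨isPreconnected_univ, by simpa using isPreconnected_empty⟩

theorem biconnected_empty [ConnectedSpace Y] : Biconnected (∅ : Set Y) :=
  ⟨isPreconnected_empty, by simpa using isPreconnected_univ⟩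

section SolidSetFunction

variable [CompactSpace Y]

theorem mem_compactSolid_iff [T2Space Y] {A : Set Y} :
    A ∈ compactSolid Y ↔ IsClosed A ∧ Biconnected A :=
  and_congr ⟨fun h => h.isClosed, fun h => h.isCompact⟩ isSolid_iff_biconnected

theorem mem_openSolid_iff {A : Set Y} : A ∈ openSolid Y ↔ IsOpen A ∧ Biconnected A :=
  ⟨fun h => ⟨h.1, isSolid_iff_biconnected.1 h.2.2⟩,
    fun h => ⟨h.1, isClosed_closure.isCompact, isSolid_iff_biconnected.2 h.2⟩⟩

variable [ConnectedSpace Y]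

variable [T2Space Y]

theorem IsSolidSetFunction.map_empty (hν : IsSolidSetFunction ν) : ν ∅ = 0 := by
  have := hν.additive 0 (fun _ => ∅) ∅ (fun i => i.elim0)
    (Or.inl (mem_compactSolid_iff.2 ⟨isClosed_empty, biconnected_empty⟩))
    (fun i => i.elim0) (by simp)
  simpa using this

theorem IsSolidSetFunction.map_add_compl (hν : IsSolidSetFunction ν) {V : Set Y} (hV : IsOpen V)
    (hVb : Biconnected V) : (ν V : ℝ) + ν Vᶜ = ν univ := by
  have := hν.additive 2 ![V, Vᶜ] univ ?_
    (Or.inl (mem_compactSolid_iff.2 ⟨isClosed_univ, biconnected_univ⟩)) ?_ ?_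
  · rw [this]
    simp
  · rw [Fin.forall_fin_two]
    exact ⟨Or.inr (mem_openSolid_iff.2 ⟨hV, hVb⟩),
      Or.inl (mem_compactSolid_iff.2 ⟨hV.isClosed_compl, hVb.compl⟩)⟩
  · intro i j hij
    fin_cases i <;> fin_cases j <;>
      first
        | exact absurd rfl hij
        | exact disjoint_compl_right
        | exact disjoint_compl_left
  · ext y
    simp [em]

theorem IsSolidSetFunction.map_compl (hν : IsSolidSetFunction ν) {C : Set Y} (hC : IsClosed C)
    (hCb : Biconnected C) : (ν C : ℝ) = ν univ - ν Cᶜ := by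
  have := hν.map_add_compl hC.isOpen_compl hCb.compl
  rw [compl_compl] at this
  linarith

theorem IsSolidSetFunction.packing (hν : IsSolidSetFunction ν) {C : Set Y} (hC : IsClosed C)
    (hCb : Biconnected C) : Packing ν C (ν C) 0 := by
  -- The whole space is the carrier of the empty family, since `{Cᶜ}` would have an empty member.
  by_cases h : C = univ
  · subst h
    have : IsCoFamily (∅ : Finset (Set Y)) := ⟨by simp, by simp, by simp, by simp⟩
    simpa [carrier, weight] using Packing.single (ν := ν) this
  · have : IsCoFamily ({Cᶜ} : Finset (Set Y)) := by
      refine ⟨?_, ?_, ?_, by simp⟩ <;> simp only [Finset.mem_singleton, forall_eq]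
      · exact hC.isOpen_compl
      · exact hCb.compl
      · exact nonempty_compl.2 h
    have h' := Packing.single (ν := ν) this
    simp only [carrier, weight, Finset.coe_singleton, sUnion_singleton, compl_compl,
      Finset.sum_singleton, Finset.card_singleton, ← hν.map_compl hC hCb] at h'
    exact h'

theorem IsSolidSetFunction.hasMass (hν : IsSolidSetFunction ν) {C : Set Y} (hC : IsClosed C)
    (hCb : Biconnected C) : HasMass ν C (ν C) := ⟨0, hν.packing hC hCb⟩

theorem IsCoFamily.solid_of_card_le_one (hν : IsSolidSetFunction ν) {𝓥 : Finset (Set Y)}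
    (h : IsCoFamily 𝓥) (hc : 𝓥.card ≤ 1) :
    Biconnected (carrier 𝓥) ∧ weight ν 𝓥 = ν (carrier 𝓥) := by
  rcases Finset.card_le_one_iff_subset_singleton.1 hc with ⟨V, hV⟩
  rcases Finset.subset_singleton_iff.1 hV with rfl | rfl
  · simpa [carrier, weight] using biconnected_univ
  · have hb := (h.biconnected V (by simp)).compl
    have ho := (h.isOpen V (by simp)).isClosed_compl
    simpa [carrier, weight, hν.map_compl ho hb] using hb

/-- By truncated subtraction, index zero means that each carrier has at most one hole, so each is a
compact solid set with `weight` equal to its `ν`-value. -/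
theorem Packing.exists_solid (hν : IsSolidSetFunction ν) {K : Set Y} {r : ℝ} {n : ℕ}
    (h : Packing ν K r n) (hn : n = 0) : ∃ (m : ℕ) (C : Fin m → Set Y),
      (∀ i, C i ∈ compactSolid Y) ∧ Pairwise (fun i j => Disjoint (C i) (C j)) ∧
      (∀ i, C i ⊆ K) ∧ r = ∑ i, (ν (C i) : ℝ) := by
  induction h with
  | empty => exact ⟨0, fun _ => ∅, fun i => i.elim0, fun i => i.elim0, fun i => i.elim0, by simp⟩
  | @cons 𝓥 K r n h1 h2 h3 ih =>
    obtain ⟨m, C, hC, hd, hs, hr⟩ := ih (by omega)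
    obtain ⟨hb, hw⟩ := h1.solid_of_card_le_one hν (by omega)
    refine ⟨m + 1, Fin.cons (carrier 𝓥) C, ?_, ?_, ?_, ?_⟩
    · intro i
      refine Fin.cases ?_ (fun i => ?_) i
      · exact mem_compactSolid_iff.2 ⟨h1.isClosed, hb⟩
      · exact hC i
    · intro i j
      refine Fin.cases ?_ (fun i => ?_) i <;> refine Fin.cases ?_ (fun j => ?_) j
      · exact fun h => absurd rfl h
      · exact fun _ => h2.mono_right (hs j)
      · exact fun _ => (h2.mono_right (hs i)).symm
      · exact fun h => hd fun h' => h (congrArg Fin.succ h')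
    · intro i
      refine Fin.cases ?_ (fun i => ?_) i
      · exact subset_union_left
      · exact (hs i).trans subset_union_right
    · rw [Fin.sum_univ_succ, hr, hw]
      simp

theorem Packing.le_univ_of_solid (hν : IsSolidSetFunction ν) {K : Set Y} {r : ℝ}
    (h : Packing ν K r 0) : r ≤ ν univ := by
  obtain ⟨m, C, hC, hd, hs, hr⟩ := h.exists_solid hν rfl
  have := hν.superadditive m C univ hC
    (mem_compactSolid_iff.2 ⟨isClosed_univ, biconnected_univ⟩) hd (subset_univ _)
  rw [hr]
  exact_mod_cast this

/-- Superadditivity bounds only by compact solid sets. Adjoining `Vᶜ` to the packing reduces the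
claim to the bound by `ν univ`. -/
theorem Packing.le_of_solid (hν : IsSolidSetFunction ν) {K V : Set Y} {r : ℝ}
    (h : Packing ν K r 0) (hV : IsOpen V) (hVb : Biconnected V) (hKV : K ⊆ V) : r ≤ ν V := by
  have h1 := (h.union (hν.packing hV.isClosed_compl hVb.compl)
    (disjoint_compl_right_iff_subset.2 hKV)).le_univ_of_solid hν
  have h2 := hν.map_add_compl hV hVb
  linarith

theorem IsSolidSetFunction.le_of_forall_closed (hν : IsSolidSetFunction ν) {U : Set Y}
    (hU : IsOpen U) (hUb : Biconnected U) {x : ℝ}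
    (h : ∀ C, IsClosed C → Biconnected C → C ⊆ U → (ν C : ℝ) ≤ x) : (ν U : ℝ) ≤ x := by
  have hx : 0 ≤ x := (NNReal.coe_nonneg _).trans
    (h ∅ isClosed_empty biconnected_empty (empty_subset _))
  lift x to ℝ≥0 using hx
  refine NNReal.coe_le_coe.2 ((hν.inner_regular U (mem_openSolid_iff.2 ⟨hU, hUb⟩)).2 ?_)
  rintro _ ⟨C, ⟨hC, hCU⟩, rfl⟩
  have hC' := mem_compactSolid_iff.1 hC
  exact NNReal.coe_le_coe.1 (h C hC'.1 hC'.2 hCU)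

end SolidSetFunction

theorem Packing.exists_nonsolid {K : Set Y} {r : ℝ} {n : ℕ} (h : Packing ν K r n) (hn : n ≠ 0) :
    ∃ (𝓥 : Finset (Set Y)) (K' : Set Y) (r' : ℝ) (n' : ℕ), IsCoFamily 𝓥 ∧ 2 ≤ 𝓥.card ∧
      Disjoint (carrier 𝓥) K' ∧ Packing ν K' r' n' ∧ K = carrier 𝓥 ∪ K' ∧
      r = weight ν 𝓥 + r' ∧ n = 𝓥.card - 1 + n' := by
  induction h with
  | empty => exact absurd rfl hn
  | @cons 𝓥 K r n h1 h2 h3 ih =>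
    by_cases hc : 2 ≤ 𝓥.card
    · exact ⟨𝓥, K, r, n, h1, hc, h2, h3, rfl, rfl, rfl⟩
    · obtain ⟨𝓦, K', r', n', w1, w2, w3, w4, w5, w6, w7⟩ := ih (by omega)
      rw [w5, disjoint_union_right] at h2
      refine ⟨𝓦, carrier 𝓥 ∪ K', weight ν 𝓥 + r', 𝓥.card - 1 + n', w1, w2,
        h2.1.symm.union_right w3, Packing.cons h1 h2.2 w4, ?_, ?_, ?_⟩
      · rw [w5, union_left_comm]
      · rw [w6]; ring
      · omega

theorem HasMass.exists_piece {K L : Set Y} {r : ℝ}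
    (h : HasMass ν K r) (hL : IsPreconnected L) (hLc : IsClosed L) (hne : L.Nonempty)
    (hLK : L ⊆ K) :
    ∃ (𝓥 : Finset (Set Y)) (K' : Set Y) (r' : ℝ), IsCoFamily 𝓥 ∧ L ⊆ carrier 𝓥 ∧
      Disjoint (carrier 𝓥) K' ∧ HasMass ν K' r' ∧ K = carrier 𝓥 ∪ K' ∧ r = weight ν 𝓥 + r' := by
  obtain ⟨n, h⟩ := h
  induction h with
  | empty => exact absurd (hne.mono hLK) (by simp)
  | @cons 𝓦 K r n h1 h2 h3 ih =>
    have hor := isPreconnected_iff_subset_of_fully_disjoint_closed hLc |>.1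
      hL _ _ h1.isClosed h3.isClosed hLK h2
    rcases hor with hs | hs
    · exact ⟨𝓦, K, r, h1, hs, h2, ⟨n, h3⟩, rfl, rfl⟩
    · obtain ⟨𝓥, K', r', i1, i2, i3, i4, i5, i6⟩ := ih hs
      rw [i5, disjoint_union_right] at h2
      refine ⟨𝓥, carrier 𝓦 ∪ K', weight ν 𝓦 + r', i1, i2, h2.1.symm.union_right i3,
        (HasMass.single h1).union i4 h2.2, ?_, ?_⟩
      · rw [i5, union_left_comm]
      · rw [i6]; ring

end Packing

/-! ### Monotonicity of mass and interpolation in genus zero -/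

section Genus

variable {Y : Type*} [TopologicalSpace Y] [T2Space Y] [CompactSpace Y] [LocallyConnectedSpace Y]
  [ConnectedSpace Y] {ν : Set Y → ℝ≥0}

theorem IsCoFamily.isPreconnected_carrier (hg : genus Y = 0) {𝓥 : Finset (Set Y)}
    (h : IsCoFamily 𝓥) : IsPreconnected (carrier 𝓥) :=
  isPreconnected_compl_sUnion_open hg 𝓥 h.isOpen h.biconnected h.disjoint

/-- Each carrier is connected, so it lies in exactly one of the disjoint open sets when nonempty;
both the mass and the index add up. -/
theorem Packing.split (hg : genus Y = 0) {𝓥 : Finset (Set Y)} (ho : ∀ V ∈ 𝓥, IsOpen V)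
    (hd : (𝓥 : Set (Set Y)).PairwiseDisjoint id) (hne : 𝓥.Nonempty) {K : Set Y} {r : ℝ} {n : ℕ}
    (h : Packing ν K r n) (hK : K ⊆ ⋃₀ (𝓥 : Set (Set Y))) :
    ∃ (ρ : Set Y → ℝ) (N : Set Y → ℕ), (∀ V ∈ 𝓥, Packing ν (K ∩ V) (ρ V) (N V)) ∧
      ∑ V ∈ 𝓥, ρ V = r ∧ ∑ V ∈ 𝓥, N V = n := by
  classical
  induction h with
  | empty => exact ⟨fun _ => 0, fun _ => 0, fun V _ => by simpa using Packing.empty,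
      by simp, by simp⟩
  | @cons 𝓦 K r n h1 h2 h3 ih =>
    obtain ⟨ρ, N, h4, h5, h6⟩ := ih (subset_union_right.trans hK)
    obtain ⟨V₀, hV₀, hsub⟩ := exists_subset_of_isPreconnected ho hd hne
      (h1.isPreconnected_carrier hg) (subset_union_left.trans hK)
    refine ⟨fun V => (if V = V₀ then weight ν 𝓦 else 0) + ρ V,
      fun V => (if V = V₀ then 𝓦.card - 1 else 0) + N V, ?_, ?_, ?_⟩
    · intro V hV
      by_cases hVV : V = V₀
      · subst hVV
        simp only [if_true]
        rw [union_inter_distrib_right, inter_eq_self_of_subset_left hsub]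
        exact Packing.cons h1 (h2.mono_right inter_subset_left) (h4 V hV)
      · simp only [hVV, if_false, zero_add]
        have hdV : Disjoint (carrier 𝓦) V := (hd hV hV₀ hVV).symm.mono_left hsub
        rw [union_inter_distrib_right, disjoint_iff_inter_eq_empty.1 hdV, empty_union]
        exact h4 V hV
    · rw [Finset.sum_add_distrib, Finset.sum_ite_eq', if_pos hV₀, h5]
    · rw [Finset.sum_add_distrib, Finset.sum_ite_eq', if_pos hV₀, h6]

/-- Induction on the index. Take a carrier with at least two holes. The connected set `Vᶜ` lies in
one hole `V₀`, and the rest of the packing is spread over the holes. By induction the parts in the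
other holes weigh at most these holes. So the total is at most that of `V₀ᶜ` together with the part
in `V₀`, a packing inside `V` of smaller index. -/
theorem Packing.le (hg : genus Y = 0) (hν : IsSolidSetFunction ν) (n : ℕ) :
    ∀ {K V : Set Y} {r : ℝ}, Packing ν K r n → IsOpen V → Biconnected V → K ⊆ V → r ≤ ν V := by
  classical
  induction n using Nat.strong_induction_on with
  | _ n ih =>
  intro K V r h hV hVb hKV
  rcases eq_or_ne n 0 with rfl | hn
  · exact h.le_of_solid hν hV hVb hKV
  obtain ⟨𝓥, K', r', n', h1, h2, h3, h4, rfl, rfl, rfl⟩ := h.exists_nonsolid hn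
  have hne : 𝓥.Nonempty := Finset.card_pos.1 (by omega)
  obtain ⟨V₀, hV₀, hsub⟩ := exists_subset_of_isPreconnected h1.isOpen h1.disjoint hne hVb.2
    (compl_subset_comm.1 (subset_union_left.trans hKV))
  obtain ⟨ρ, N, p1, p2, p3⟩ := h4.split hg h1.isOpen h1.disjoint hne
    (subset_compl_iff_disjoint_left.2 h3 |>.trans_eq (compl_compl _))
  have hN : ∀ W ∈ 𝓥, N W < 𝓥.card - 1 + n' := fun W hW => by
    have := Finset.single_le_sum (f := N) (fun _ _ => Nat.zero_le _) hW
    omega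
  have hothers : ∑ W ∈ 𝓥.erase V₀, ρ W ≤ ∑ W ∈ 𝓥.erase V₀, (ν W : ℝ) :=
    Finset.sum_le_sum fun W hW => by
      have hW' := Finset.mem_of_mem_erase hW
      exact ih _ (hN W hW') (p1 W hW') (h1.isOpen W hW') (h1.biconnected W hW') inter_subset_right
  have hpack := (hν.packing (h1.isOpen V₀ hV₀).isClosed_compl
    (h1.biconnected V₀ hV₀).compl).union (p1 V₀ hV₀)
    (disjoint_compl_left.mono_right inter_subset_right)
  have hmain := ih _ (by have := hN V₀ hV₀; omega) hpack hV hVb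
    (union_subset (compl_subset_comm.1 hsub)
      (inter_subset_left.trans (subset_union_right.trans hKV)))
  have hadd := hν.map_add_compl (h1.isOpen V₀ hV₀) (h1.biconnected V₀ hV₀)
  rw [← Finset.add_sum_erase _ _ hV₀] at p2
  rw [weight, ← Finset.add_sum_erase _ _ hV₀]
  linarith

theorem HasMass.le (hg : genus Y = 0) (hν : IsSolidSetFunction ν) {K V : Set Y} {r : ℝ}
    (h : HasMass ν K r) (hV : IsOpen V) (hVb : Biconnected V) (hKV : K ⊆ V) : r ≤ ν V :=
  h.elim fun n h => Packing.le hg hν n h hV hVb hKV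

theorem HasMass.le_univ (hg : genus Y = 0) (hν : IsSolidSetFunction ν) {K : Set Y} {r : ℝ}
    (h : HasMass ν K r) : r ≤ ν univ :=
  h.le hg hν isOpen_univ biconnected_univ (subset_univ _)

theorem IsSolidSetFunction.mono_open (hg : genus Y = 0) (hν : IsSolidSetFunction ν) {V U : Set Y}
    (hV : IsOpen V) (hVb : Biconnected V) (hU : IsOpen U) (hUb : Biconnected U) (h : V ⊆ U) :
    (ν V : ℝ) ≤ ν U :=
  hν.le_of_forall_closed hV hVb fun _ hC hCb hCV =>
    (hν.hasMass hC hCb).le hg hν hU hUb (hCV.trans h)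

/-- Inner regularity replaces each hole by a closed solid subset, one at a time, which is then
absorbed into the packing. -/
theorem HasMass.add_sum_le (hg : genus Y = 0) (hν : IsSolidSetFunction ν)
    (𝓥 : Finset (Set Y)) : ∀ {K : Set Y} {r : ℝ}, IsCoFamily 𝓥 → HasMass ν K r →
      K ⊆ carrier 𝓥 → r + ∑ V ∈ 𝓥, (ν V : ℝ) ≤ ν univ := by
  classical
  induction 𝓥 using Finset.induction_on with
  | empty => intro K r _ h _; simpa using h.le_univ hg hν
  | insert V 𝓥 hV ih =>
    intro K r h hK hKc
    have h' : IsCoFamily 𝓥 := ⟨fun W hW => h.isOpen W (Finset.mem_insert_of_mem hW),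
      fun W hW => h.biconnected W (Finset.mem_insert_of_mem hW),
      fun W hW => h.nonempty W (Finset.mem_insert_of_mem hW),
      h.disjoint.subset (by simp)⟩
    have hVm := Finset.mem_insert_self V 𝓥
    suffices (ν V : ℝ) ≤ ν univ - r - ∑ W ∈ 𝓥, (ν W : ℝ) by
      rw [Finset.sum_insert hV]; linarith
    refine hν.le_of_forall_closed (h.isOpen V hVm) (h.biconnected V hVm) fun C hC hCb hCV => ?_
    have := ih h' (hK.union (hν.hasMass hC hCb) ?_) ?_
    · linarith
    · exact Set.disjoint_left.2 fun z hz hzC => mem_carrier.1 (hKc hz) V hVm (hCV hzC)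
    · rintro z (hz | hz)
      · exact mem_carrier.2 fun W hW => mem_carrier.1 (hKc hz) W (Finset.mem_insert_of_mem hW)
      · refine mem_carrier.2 fun W hW hzW => Set.disjoint_left.1 (h.disjoint hVm
          (Finset.mem_insert_of_mem hW) ?_) (hCV hz) hzW
        rintro rfl
        exact hV hW

theorem HasMass.le_weight (hg : genus Y = 0) (hν : IsSolidSetFunction ν) {𝓥 : Finset (Set Y)}
    {K : Set Y} {r : ℝ} (h : HasMass ν K r) (h𝓥 : IsCoFamily 𝓥) (hK : K ⊆ carrier 𝓥) :
    r ≤ weight ν 𝓥 := by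
  have := h.add_sum_le hg hν 𝓥 h𝓥 hK
  rw [weight]
  linarith

theorem HasMass.split (hg : genus Y = 0) {A B K : Set Y} (hA : IsClosed A)
    (hB : IsClosed B) (hAB : Disjoint A B) {r : ℝ} (h : HasMass ν K r) (hK : K ⊆ A ∪ B) :
    ∃ r₁ r₂, HasMass ν (K ∩ A) r₁ ∧ HasMass ν (K ∩ B) r₂ ∧ r = r₁ + r₂ := by
  obtain ⟨n, h⟩ := h
  induction h with
  | empty => exact ⟨0, 0, by simpa using HasMass.empty, by simpa using HasMass.empty, by simp⟩
  | @cons 𝓦 K r n h1 h2 h3 ih =>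
    obtain ⟨r₁, r₂, i1, i2, i3⟩ := ih (subset_union_right.trans hK)
    have hor := isPreconnected_iff_subset_of_fully_disjoint_closed h1.isClosed |>.1
      (h1.isPreconnected_carrier hg) A B hA hB (subset_union_left.trans hK) hAB
    rw [union_inter_distrib_right, union_inter_distrib_right]
    rcases hor with hs | hs
    · refine ⟨weight ν 𝓦 + r₁, r₂, ?_, ?_, by rw [i3]; ring⟩
      · rw [inter_eq_self_of_subset_left hs]
        exact (HasMass.single h1).union i1 (h2.mono_right inter_subset_left)
      · rw [disjoint_iff_inter_eq_empty.1 (hAB.mono_left hs), empty_union]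
        exact i2
    · refine ⟨r₁, weight ν 𝓦 + r₂, ?_, ?_, by rw [i3]; ring⟩
      · rw [disjoint_iff_inter_eq_empty.1 (hAB.symm.mono_left hs), empty_union]
        exact i1
      · rw [inter_eq_self_of_subset_left hs]
        exact (HasMass.single h1).union i2 (h2.mono_right inter_subset_left)

/-- Splitting along the carriers of `K'` reduces to a single carrier. In particular, the mass
depends only on the set and not on its decomposition. -/
theorem HasMass.mono (hg : genus Y = 0) (hν : IsSolidSetFunction ν) {K' : Set Y} {r' : ℝ}
    (h' : HasMass ν K' r') : ∀ {K : Set Y} {r : ℝ}, HasMass ν K r → K ⊆ K' → r ≤ r' := by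
  obtain ⟨n, h'⟩ := h'
  induction h' with
  | empty =>
    intro K r h hK
    have := h.le hg hν isOpen_empty biconnected_empty hK
    rwa [hν.map_empty] at this
  | cons h1 h2 h3 ih =>
    intro K r h hK
    obtain ⟨r₁, r₂, i1, i2, rfl⟩ := h.split hg h1.isClosed h3.isClosed h2 hK
    exact add_le_add (i1.le_weight hg hν h1 inter_subset_right) (ih i2 inter_subset_right)

/-- The holes are the components of `Lᶜ` that meet `Oᶜ`. They are finite in number because `Oᶜ` is
compact. -/
theorem exists_coFamily_between {L O : Set Y} (hL : IsClosed L) (hLc : IsPreconnected L)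
    (hne : L.Nonempty) (hO : IsOpen O) (hLO : L ⊆ O) :
    ∃ 𝓥 : Finset (Set Y), IsCoFamily 𝓥 ∧ L ⊆ carrier 𝓥 ∧ carrier 𝓥 ⊆ O := by
  have hfin := finite_components_meeting hL.isOpen_compl hO.isClosed_compl.isCompact
    (compl_subset_compl.2 hLO)
  refine ⟨hfin.toFinset, ⟨?_, ?_, ?_, ?_⟩, ?_, ?_⟩
  · intro V hV
    obtain ⟨x, hx, rfl⟩ := hfin.mem_toFinset.1 hV
    exact hL.isOpen_compl.connectedComponentIn
  · intro V hV
    obtain ⟨x, hx, rfl⟩ := hfin.mem_toFinset.1 hV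
    exact ⟨isPreconnected_connectedComponentIn, isPreconnected_compl_component_compl hL hne hLc x⟩
  · intro V hV
    obtain ⟨x, hx, rfl⟩ := hfin.mem_toFinset.1 hV
    exact ⟨x, mem_connectedComponentIn fun h => hx (hLO h)⟩
  · intro V hV W hW hVW
    obtain ⟨x, hx, rfl⟩ := hfin.mem_toFinset.1 hV
    obtain ⟨y, hy, rfl⟩ := hfin.mem_toFinset.1 hW
    exact (component_eq_or_disjoint Lᶜ x y).resolve_left hVW
  · intro z hz
    refine mem_carrier.2 fun V hV hzV => ?_
    obtain ⟨x, hx, rfl⟩ := hfin.mem_toFinset.1 hV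
    exact connectedComponentIn_subset _ _ hzV hz
  · intro z hz
    by_contra hzO
    exact mem_carrier.1 hz _ (hfin.mem_toFinset.2 ⟨z, hzO, rfl⟩)
      (mem_connectedComponentIn fun h => hzO (hLO h))

theorem exists_hasMass_between_sUnion (ν : Set Y → ℝ≥0) (𝓤 : Finset (Set Y)) :
    ∀ {K : Set Y}, (∀ U ∈ 𝓤, IsOpen U) → (∀ U ∈ 𝓤, IsPreconnected U) →
      (𝓤 : Set (Set Y)).PairwiseDisjoint id → IsClosed K → K ⊆ ⋃₀ (𝓤 : Set (Set Y)) →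
      ∃ K' r, HasMass ν K' r ∧ K ⊆ interior K' ∧ K' ⊆ ⋃₀ (𝓤 : Set (Set Y)) := by
  classical
  induction 𝓤 using Finset.induction_on with
  | empty =>
    intro K _ _ _ _ hK
    exact ⟨∅, 0, HasMass.empty, by simpa using hK, empty_subset _⟩
  | insert U 𝓤 hU ih =>
    intro K ho hp hd hKc hK
    rw [Finset.coe_insert, sUnion_insert] at hK ⊢
    have hUm := Finset.mem_insert_self U 𝓤
    have ho' : IsOpen (⋃₀ (𝓤 : Set (Set Y))) :=
      isOpen_sUnion fun V hV => ho V (Finset.mem_insert_of_mem hV)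
    have hUd : Disjoint U (⋃₀ (𝓤 : Set (Set Y))) := disjoint_sUnion_right.2 fun V hV =>
      hd hUm (Finset.mem_insert_of_mem hV) fun h => hU (h ▸ hV)
    have hK1 : K \ ⋃₀ (𝓤 : Set (Set Y)) ⊆ U := fun z hz => (hK hz.1).resolve_right hz.2
    have hK2 : K \ U ⊆ ⋃₀ (𝓤 : Set (Set Y)) := fun z hz => (hK hz.1).resolve_left hz.2
    obtain ⟨K₂, r₂, a1, a2, a3⟩ := ih (fun V hV => ho V (Finset.mem_insert_of_mem hV))
      (fun V hV => hp V (Finset.mem_insert_of_mem hV)) (hd.subset (by simp))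
      (hKc.sdiff (ho U hUm)) hK2
    obtain ⟨K₁, r₁, b1, b2, b3⟩ : ∃ K' r, HasMass ν K' r ∧
        K \ ⋃₀ (𝓤 : Set (Set Y)) ⊆ interior K' ∧ K' ⊆ U := by
      obtain ⟨D, d1, d2, d3, d4⟩ := exists_connected_closed_between (ho U hUm) (hp U hUm)
        (hKc.sdiff ho') hK1
      rcases D.eq_empty_or_nonempty with rfl | hne
      · exact ⟨∅, 0, HasMass.empty, d3, empty_subset _⟩
      · obtain ⟨𝓥, h1, h2, h3⟩ := exists_coFamily_between d1 d2 hne (ho U hUm) d4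
        exact ⟨_, _, HasMass.single h1, d3.trans (interior_mono h2), h3⟩
    refine ⟨K₁ ∪ K₂, r₁ + r₂, b1.union a1 ((hUd.mono_left b3).mono_right a3), ?_,
      union_subset_union b3 a3⟩
    intro z hz
    rcases hK hz with h | h
    · exact interior_mono subset_union_left (b2 ⟨hz, Set.disjoint_left.1 hUd h⟩)
    · exact interior_mono subset_union_right (a2 ⟨hz, Set.disjoint_right.1 hUd h⟩)

/-- The compact set `K` meets only finitely many components of `U`, and in each of them a connected
closed set interpolates and then a carrier. -/
theorem exists_hasMass_between (ν : Set Y → ℝ≥0) {K U : Set Y} (hK : IsClosed K) (hU : IsOpen U)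
    (hKU : K ⊆ U) : ∃ K' r, HasMass ν K' r ∧ K ⊆ interior K' ∧ K' ⊆ U := by
  have hfin := finite_components_meeting hU hK.isCompact hKU
  have key := exists_hasMass_between_sUnion ν hfin.toFinset (K := K) ?_ ?_ ?_ hK ?_
  · obtain ⟨K', r, h1, h2, h3⟩ := key
    refine ⟨K', r, h1, h2, h3.trans (sUnion_subset ?_)⟩
    intro V hV
    obtain ⟨x, hx, rfl⟩ := hfin.mem_toFinset.1 hV
    exact connectedComponentIn_subset _ _
  · intro V hV
    obtain ⟨x, hx, rfl⟩ := hfin.mem_toFinset.1 hV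
    exact hU.connectedComponentIn
  · intro V hV
    obtain ⟨x, hx, rfl⟩ := hfin.mem_toFinset.1 hV
    exact isPreconnected_connectedComponentIn
  · intro V hV W hW hVW
    obtain ⟨x, hx, rfl⟩ := hfin.mem_toFinset.1 hV
    obtain ⟨y, hy, rfl⟩ := hfin.mem_toFinset.1 hW
    exact (component_eq_or_disjoint U x y).resolve_left hVW
  · intro z hz
    exact ⟨_, hfin.mem_toFinset.2 ⟨z, hz, rfl⟩, mem_connectedComponentIn (hKU hz)⟩

theorem IsSolidSetFunction.exists_open_lt (hg : genus Y = 0) (hν : IsSolidSetFunction ν)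
    {C O : Set Y} (hC : IsClosed C) (hCb : Biconnected C) (hO : IsOpen O) (hCO : C ⊆ O)
    {ε : ℝ} (hε : 0 < ε) :
    ∃ V, IsOpen V ∧ Biconnected V ∧ C ⊆ V ∧ closure V ⊆ O ∧ (ν V : ℝ) < ν C + ε := by
  obtain ⟨U, hU, hCU, hUε⟩ : ∃ U, U ∈ openSolid Y ∧ C ⊆ U ∧ (ν U : ℝ) < ν C + ε := by
    lift ε to ℝ≥0 using hε.le
    by_contra! h
    have hlb : ν C + ε ∈ lowerBounds (ν '' {U | U ∈ openSolid Y ∧ C ⊆ U}) := by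
      rintro _ ⟨U, ⟨hU, hCU⟩, rfl⟩
      exact_mod_cast h U hU hCU
    have h' : (ν C : ℝ) + ε ≤ ν C := by
      exact_mod_cast (hν.outer_regular C (mem_compactSolid_iff.2 ⟨hC, hCb⟩)).2 hlb
    linarith
  have hU' := mem_openSolid_iff.1 hU
  obtain ⟨V, h1, h2, h3, h4⟩ := exists_open_biconnected_between hC hCb (hO.inter hU'.1)
    (subset_inter hCO hCU)
  exact ⟨V, h1, h2, h3, h4.trans inter_subset_left, (hν.mono_open hg h1 h2 hU'.1 hU'.2
    (subset_closure.trans (h4.trans inter_subset_right))).trans_lt hUε⟩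

end Genus

/-! ### Inner mass of open sets: cutting, modularity and additivity -/

theorem innerMass_le {Y : Type*} [TopologicalSpace Y] {ν : Set Y → ℝ≥0} {U : Set Y} {x : ℝ}
    (h : ∀ K r, K ⊆ U → HasMass ν K r → r ≤ x) : innerMass ν U ≤ x :=
  csSup_le ⟨0, ∅, empty_subset _, HasMass.empty⟩ (by rintro r ⟨K, hK, hr⟩; exact h K r hK hr)

section InnerMass

variable {Y : Type*} [TopologicalSpace Y] [T2Space Y] [CompactSpace Y] [LocallyConnectedSpace Y]
  [ConnectedSpace Y] {ν : Set Y → ℝ≥0}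

theorem HasMass.le_innerMass (hg : genus Y = 0) (hν : IsSolidSetFunction ν) {K U : Set Y} {r : ℝ}
    (h : HasMass ν K r) (hKU : K ⊆ U) : r ≤ innerMass ν U :=
  le_csSup ⟨ν univ, by rintro _ ⟨K, -, hK⟩; exact hK.le_univ hg hν⟩ ⟨K, hKU, h⟩

theorem innerMass_nonneg (hg : genus Y = 0) (hν : IsSolidSetFunction ν) (U : Set Y) :
    0 ≤ innerMass ν U := HasMass.empty.le_innerMass hg hν (empty_subset _)

theorem innerMass_mono (hg : genus Y = 0) (hν : IsSolidSetFunction ν) {U V : Set Y} (h : U ⊆ V) :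
    innerMass ν U ≤ innerMass ν V :=
  innerMass_le fun _ _ hK hr => hr.le_innerMass hg hν (hK.trans h)

open Classical in
-- The carrier is obtained from `O` by thickening `Oᶜ` slightly to an open solid `O'`, away from the
-- holes of `𝓥` inside `O`, and removing `O'` and these holes. The thickening costs at most `ε`.
theorem exists_carrier_near (hg : genus Y = 0) (hν : IsSolidSetFunction ν)
    {𝓞 𝓥 : Finset (Set Y)} (hO : IsCoFamily 𝓞) (hV : IsCoFamily 𝓥)
    (hne : (carrier 𝓞).Nonempty) (hsub : carrier 𝓞 ⊆ interior (carrier 𝓥)) {O : Set Y}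
    (hOm : O ∈ 𝓞) {ε : ℝ} (hε : 0 < ε) :
    ∃ N s, HasMass ν N s ∧ N ⊆ carrier 𝓥 ∩ O ∧
      (ν O : ℝ) - ∑ V ∈ 𝓥, (if V ⊆ O then (ν V : ℝ) else 0) - ε ≤ s := by
  classical
  have hOV : (⋃₀ (𝓥 : Set (Set Y))) ⊆ ⋃₀ (𝓞 : Set (Set Y)) :=
    compl_subset_compl.1 (hsub.trans interior_subset)
  have hOc : Oᶜ ⊆ (closure ((carrier 𝓥)ᶜ ∩ O))ᶜ := by
    intro z hz hzc
    have hzM : z ∈ (carrier 𝓞)ᶜ := fun h => by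
      have h1 := closure_mono inter_subset_left hzc
      rw [closure_compl] at h1
      exact h1 (hsub h)
    obtain ⟨O₁, hO₁, hzO₁⟩ := not_not.1 hzM
    obtain ⟨y, hy1, hy2⟩ := mem_closure_iff.1 hzc O₁ (hO.isOpen O₁ hO₁) hzO₁
    refine Set.disjoint_left.1 (hO.disjoint hO₁ hOm ?_) hy1 hy2.2
    rintro rfl
    exact hz hzO₁
  obtain ⟨O', h1, h2, h3, h4, h5⟩ := hν.exists_open_lt hg (hO.isOpen O hOm).isClosed_compl
    (hO.biconnected O hOm).compl isClosed_closure.isOpen_compl hOc hε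
  have hdO' : ∀ V ∈ 𝓥, V ⊆ O → Disjoint O' V := fun V hV hVO =>
    Set.disjoint_left.2 fun z hz hzV => h4 (subset_closure hz) (subset_closure
      ⟨fun h => mem_carrier.1 h V hV hzV, hVO hzV⟩)
  have hO'ne : O'.Nonempty := by
    obtain ⟨z, hz⟩ := hne
    exact ⟨z, h3 (mem_carrier.1 hz O hOm)⟩
  have hmem : ∀ V ∈ insert O' (𝓥.filter (· ⊆ O)), V = O' ∨ (V ∈ 𝓥 ∧ V ⊆ O) := by
    intro V hV
    simpa using hV
  have hco : IsCoFamily (insert O' (𝓥.filter (· ⊆ O))) := by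
    refine ⟨?_, ?_, ?_, ?_⟩
    · intro V hm
      rcases hmem V hm with rfl | h
      exacts [h1, hV.isOpen V h.1]
    · intro V hm
      rcases hmem V hm with rfl | h
      exacts [h2, hV.biconnected V h.1]
    · intro V hm
      rcases hmem V hm with rfl | h
      exacts [hO'ne, hV.nonempty V h.1]
    · intro V hm W hm' hVW
      rcases hmem V hm with rfl | h <;> rcases hmem W hm' with rfl | h'
      · exact absurd rfl hVW
      · exact hdO' W h'.1 h'.2
      · exact (hdO' V h.1 h.2).symm
      · exact hV.disjoint h.1 h'.1 hVW
  have hnot : O' ∉ 𝓥.filter (· ⊆ O) := fun h => by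
    obtain ⟨z, hz⟩ := hO'ne
    rw [Finset.mem_filter] at h
    exact Set.disjoint_left.1 (hdO' O' h.1 h.2) hz hz
  refine ⟨_, _, HasMass.single hco, ?_, ?_⟩
  · intro z hz
    rw [mem_carrier] at hz
    have hzO : z ∈ O := by
      by_contra h
      exact hz O' (Finset.mem_insert_self _ _) (h3 h)
    refine ⟨mem_carrier.2 fun V hVm hzV => ?_, hzO⟩
    obtain ⟨O₁, hO₁, hVO₁⟩ := exists_subset_of_isPreconnected hO.isOpen hO.disjoint ⟨O, hOm⟩
      (hV.biconnected V hVm).1 ((subset_sUnion_of_mem hVm).trans hOV)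
    by_cases hOO : O₁ = O
    · subst hOO
      exact hz V (Finset.mem_insert_of_mem (Finset.mem_filter.2 ⟨hVm, hVO₁⟩)) hzV
    · exact Set.disjoint_left.1 (hO.disjoint hO₁ hOm hOO) (hVO₁ hzV) hzO
  · rw [weight, Finset.sum_insert hnot, Finset.sum_filter]
    have := hν.map_add_compl (hO.isOpen O hOm) (hO.biconnected O hOm)
    linarith

/-- Sum the preceding approximations over the holes `O` of `𝓞`. Each hole of `𝓥` lies in exactly one
of them, so the total is the difference of the weights. -/
theorem exists_hasMass_sdiff (hg : genus Y = 0) (hν : IsSolidSetFunction ν)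
    {𝓞 𝓥 : Finset (Set Y)} (hO : IsCoFamily 𝓞) (hV : IsCoFamily 𝓥)
    (hne : (carrier 𝓞).Nonempty) (hsub : carrier 𝓞 ⊆ interior (carrier 𝓥))
    {ε : ℝ} (hε : 0 < ε) :
    ∃ N s, HasMass ν N s ∧ N ⊆ carrier 𝓥 \ carrier 𝓞 ∧ weight ν 𝓥 - weight ν 𝓞 - ε ≤ s := by
  classical
  have key : ∀ t ⊆ 𝓞, ∀ δ > 0, ∃ N s, HasMass ν N s ∧ N ⊆ carrier 𝓥 ∩ ⋃₀ (t : Set (Set Y)) ∧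
      ∑ O ∈ t, ((ν O : ℝ) - ∑ V ∈ 𝓥, (if V ⊆ O then (ν V : ℝ) else 0)) - δ ≤ s := by
    intro t
    induction t using Finset.induction_on with
    | empty =>
      intro _ δ hδ
      exact ⟨∅, 0, HasMass.empty, empty_subset _, by simpa using hδ.le⟩
    | insert O t hOt ih =>
      intro ht δ hδ
      have hOm := ht (Finset.mem_insert_self O t)
      have ht' : t ⊆ 𝓞 := (Finset.subset_insert O t).trans ht
      obtain ⟨N, s, n1, n2, n3⟩ := ih ht' (δ / 2) (half_pos hδ)
      obtain ⟨N', s', m1, m2, m3⟩ := exists_carrier_near hg hν hO hV hne hsub hOm (half_pos hδ)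
      refine ⟨N' ∪ N, s' + s, m1.union n1 ?_, ?_, ?_⟩
      · refine Disjoint.mono (m2.trans inter_subset_right) (n2.trans inter_subset_right)
          (disjoint_sUnion_right.2 fun P hP => hO.disjoint hOm (ht' hP) ?_)
        rintro rfl
        exact hOt hP
      · rw [Finset.coe_insert, sUnion_insert, inter_union_distrib_left]
        exact union_subset_union m2 n2
      · rw [Finset.sum_insert hOt]
        linarith
  obtain ⟨N, s, h1, h2, h3⟩ := key 𝓞 Subset.rfl ε hε
  refine ⟨N, s, h1, fun z hz => ⟨(h2 hz).1, fun h => h (h2 hz).2⟩, ?_⟩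
  have hsum : ∑ O ∈ 𝓞, ∑ V ∈ 𝓥, (if V ⊆ O then (ν V : ℝ) else 0) = ∑ V ∈ 𝓥, (ν V : ℝ) := by
    rw [Finset.sum_comm]
    refine Finset.sum_congr rfl fun V hVm => ?_
    have hVsub : V ⊆ ⋃₀ (𝓞 : Set (Set Y)) := (subset_sUnion_of_mem hVm).trans
      (compl_subset_compl.1 (hsub.trans interior_subset))
    obtain ⟨z, hz⟩ := hV.nonempty V hVm
    obtain ⟨P, hP, -⟩ := hVsub hz
    obtain ⟨O₁, hO₁, hVO₁⟩ := exists_subset_of_isPreconnected hO.isOpen hO.disjoint ⟨P, hP⟩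
      (hV.biconnected V hVm).1 hVsub
    rw [Finset.sum_eq_single_of_mem O₁ hO₁, if_pos hVO₁]
    intro O hO' hne'
    exact if_neg fun h => Set.disjoint_left.1 (hO.disjoint hO' hO₁ hne') (h hz) (hVO₁ hz)
  rw [Finset.sum_sub_distrib, hsum] at h3
  rw [weight, weight]
  linarith

/-- Enlarge the competitor and `carrier 𝓞` to one union of carriers inside `U`. Being connected,
`carrier 𝓞` lies in the interior of a single piece, and only that piece has to be replaced. -/
theorem innerMass_le_sdiff_carrier (hg : genus Y = 0) (hν : IsSolidSetFunction ν)
    {𝓞 : Finset (Set Y)} (hO : IsCoFamily 𝓞) {U : Set Y} (hU : IsOpen U) (h : carrier 𝓞 ⊆ U) :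
    innerMass ν U ≤ innerMass ν (U \ carrier 𝓞) + weight ν 𝓞 := by
  rcases (carrier 𝓞).eq_empty_or_nonempty with he | hne
  · rw [he, sdiff_empty]
    have := HasMass.empty.le_weight hg hν hO (empty_subset _)
    linarith
  refine innerMass_le fun K r hK hr => le_of_forall_pos_le_add fun ε hε => ?_
  obtain ⟨K', r', h1, h2, h3⟩ := exists_hasMass_between ν (hr.isClosed.union hO.isClosed) hU
    (union_subset hK h)
  have hrr' := h1.mono hg hν hr (subset_union_left.trans (h2.trans interior_subset))
  obtain ⟨𝓥, K'', r'', i1, i2, i3, i4, i5, i6⟩ := h1.exists_piece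
    (hO.isPreconnected_carrier hg) hO.isClosed hne
    (subset_union_right.trans (h2.trans interior_subset))
  have hint : carrier 𝓞 ⊆ interior (carrier 𝓥) := by
    have h4 : carrier 𝓞 ⊆ interior K' ∩ K''ᶜ := fun z hz =>
      ⟨h2 (Or.inr hz), Set.disjoint_left.1 i3 (i2 hz)⟩
    refine h4.trans (interior_maximal ?_ (isOpen_interior.inter i4.isClosed.isOpen_compl))
    rintro z ⟨hz1, hz2⟩
    have := interior_subset hz1
    rw [i5] at this
    exact this.resolve_right hz2
  obtain ⟨N, s, n1, n2, n3⟩ := exists_hasMass_sdiff hg hν hO i1 hne hint hε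
  have hfin := (n1.union i4 (i3.mono_left (n2.trans sdiff_subset))).le_innerMass hg hν
    (U := U \ carrier 𝓞) ?_
  · linarith
  · have hK'U := i5 ▸ h3
    refine union_subset (fun z hz => ⟨hK'U (Or.inl (n2 hz).1), (n2 hz).2⟩) fun z hz =>
      ⟨hK'U (Or.inr hz), fun h' => Set.disjoint_left.1 i3 (i2 h') hz⟩

theorem HasMass.innerMass_le_sdiff (hg : genus Y = 0) (hν : IsSolidSetFunction ν) {K : Set Y}
    {r : ℝ} (h : HasMass ν K r) : ∀ {U : Set Y}, IsOpen U → K ⊆ U →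
      innerMass ν U ≤ innerMass ν (U \ K) + r := by
  obtain ⟨n, h⟩ := h
  induction h with
  | empty => intro U _ _; simp
  | cons h1 h2 h3 ih =>
    intro U hU hKU
    have a := innerMass_le_sdiff_carrier hg hν h1 hU (subset_union_left.trans hKU)
    have b := ih (hU.sdiff h1.isClosed) fun z hz =>
      ⟨hKU (Or.inr hz), Set.disjoint_right.1 h2 hz⟩
    rw [sdiff_sdiff] at b
    linarith

theorem innerMass_univ (hg : genus Y = 0) (hν : IsSolidSetFunction ν) :
    innerMass ν (univ : Set Y) = ν univ :=
  le_antisymm (innerMass_le fun _ _ _ h => h.le_univ hg hν)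
    ((hν.hasMass isClosed_univ biconnected_univ).le_innerMass hg hν Subset.rfl)

theorem HasMass.le_innerMass_compl (hg : genus Y = 0) (hν : IsSolidSetFunction ν) {K : Set Y}
    {r : ℝ} (h : HasMass ν K r) : (ν univ : ℝ) ≤ innerMass ν Kᶜ + r := by
  have := h.innerMass_le_sdiff hg hν isOpen_univ (subset_univ _)
  rwa [innerMass_univ hg hν, ← compl_eq_univ_sdiff] at this

/-- The complements of `U` and `V` are disjoint closed sets. Enclosing them in disjoint sets `K` and
`L` with masses turns both inequalities into comparisons of total mass with packings and with inner
masses of complements. -/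
theorem innerMass_union_add_inter (hg : genus Y = 0) (hν : IsSolidSetFunction ν) {U V : Set Y}
    (hU : IsOpen U) (hV : IsOpen V) (hUV : U ∪ V = univ) :
    innerMass ν U + innerMass ν V = innerMass ν (U ∩ V) + ν univ := by
  have hsep : ∀ {F G : Set Y}, IsClosed F → IsClosed G → Disjoint F G →
      ∃ K r, HasMass ν K r ∧ F ⊆ K ∧ Disjoint K G := fun hF hG hd => by
    obtain ⟨K, r, h1, h2, h3⟩ := exists_hasMass_between ν hF hG.isOpen_compl
      (subset_compl_iff_disjoint_right.2 hd)
    exact ⟨K, r, h1, h2.trans interior_subset, subset_compl_iff_disjoint_right.1 h3⟩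
  have hd : Disjoint Uᶜ Vᶜ := by
    rw [Set.disjoint_left]
    intro z hz1 hz2
    rcases (hUV ▸ mem_univ z : z ∈ U ∪ V) with h | h
    exacts [hz1 h, hz2 h]
  refine le_antisymm ?_ ?_
  · refine le_sub_iff_add_le.1 (innerMass_le fun A a hA ha => ?_)
    rw [le_sub_comm]
    refine innerMass_le fun B b hB hb => ?_
    have hUA : Disjoint Uᶜ A := disjoint_compl_left_iff_subset.2 hA
    have hVB : Disjoint Vᶜ B := disjoint_compl_left_iff_subset.2 hB
    obtain ⟨P, Q, hP, hQ, hUP, hVQ, hPQ⟩ := normal_separation hU.isClosed_compl hV.isClosed_compl hd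
    obtain ⟨K, r, k1, k2, k3⟩ := hsep hU.isClosed_compl (ha.isClosed.union hP.isClosed_compl)
      (hUA.union_right (disjoint_compl_right_iff_subset.2 hUP))
    obtain ⟨L, s, l1, l2, l3⟩ := hsep hV.isClosed_compl (hb.isClosed.union hQ.isClosed_compl)
      (hVB.union_right (disjoint_compl_right_iff_subset.2 hVQ))
    rw [disjoint_union_right] at k3 l3
    have hKL : Disjoint K L := hPQ.mono (disjoint_compl_right_iff_subset.1 k3.2)
      (disjoint_compl_right_iff_subset.1 l3.2)
    have e1 := (k1.union ha k3.1).le_univ hg hν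
    have e2 := (l1.union hb l3.1).le_univ hg hν
    have e3 := (k1.union l1 hKL).le_innerMass_compl hg hν
    have e4 := innerMass_mono hg hν (U := (K ∪ L)ᶜ) (V := U ∩ V) (ν := ν) (by
      rw [compl_union]
      exact inter_subset_inter (compl_subset_comm.1 k2) (compl_subset_comm.1 l2))
    linarith
  · refine le_sub_iff_add_le.1 (innerMass_le fun A a hA ha => ?_)
    obtain ⟨K, r, k1, k2, k3⟩ := hsep hU.isClosed_compl (ha.isClosed.union hV.isClosed_compl)
      (Disjoint.union_right (disjoint_compl_left_iff_subset.2 (hA.trans inter_subset_left)) hd)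
    rw [disjoint_union_right] at k3
    obtain ⟨L, s, l1, l2, l3⟩ := hsep hV.isClosed_compl (ha.isClosed.union k1.isClosed)
      (Disjoint.union_right (disjoint_compl_left_iff_subset.2 (hA.trans inter_subset_right))
        k3.2.symm)
    rw [disjoint_union_right] at l3
    have e1 := ((k1.union l1 l3.2.symm).union ha (k3.1.union_left l3.1)).le_univ hg hν
    have e2 := k1.le_innerMass_compl hg hν
    have e3 := l1.le_innerMass_compl hg hν
    have e4 := innerMass_mono hg hν (compl_subset_comm.1 k2) (ν := ν)
    have e5 := innerMass_mono hg hν (compl_subset_comm.1 l2) (ν := ν)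
    linarith

theorem innerMass_union_of_disjoint (hg : genus Y = 0) (hν : IsSolidSetFunction ν) {U V : Set Y}
    (hU : IsOpen U) (hV : IsOpen V) (hUV : Disjoint U V) :
    innerMass ν (U ∪ V) = innerMass ν U + innerMass ν V := by
  refine le_antisymm (innerMass_le fun K r hK hr => ?_) ?_
  · have hd1 : Disjoint (K \ V) (K \ U) := Set.disjoint_left.2 fun z h1 h2 =>
      (hK h1.1).elim h2.2 h1.2
    obtain ⟨r₁, r₂, h1, h2, rfl⟩ := hr.split hg (hr.isClosed.sdiff hV) (hr.isClosed.sdiff hU) hd1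
      (fun z hz => (hK hz).imp (fun h => ⟨hz, Set.disjoint_left.1 hUV h⟩)
        (fun h => ⟨hz, Set.disjoint_right.1 hUV h⟩))
    exact add_le_add
      (h1.le_innerMass hg hν fun z hz => (hK hz.1).resolve_right hz.2.2)
      (h2.le_innerMass hg hν fun z hz => (hK hz.1).resolve_left hz.2.2)
  · refine le_sub_iff_add_le.1 (innerMass_le fun A a hA ha => ?_)
    rw [le_sub_comm]
    refine innerMass_le fun B b hB hb => ?_
    have := (ha.union hb (hUV.mono hA hB)).le_innerMass hg hν (union_subset_union hA hB)
    linarith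

theorem innerMass_of_biconnected (hg : genus Y = 0) (hν : IsSolidSetFunction ν) {V : Set Y}
    (hV : IsOpen V) (hVb : Biconnected V) : innerMass ν V = ν V :=
  le_antisymm (innerMass_le fun _ _ hK h => h.le hg hν hV hVb hK)
    (hν.le_of_forall_closed hV hVb fun _ hC hCb hCV =>
      (hν.hasMass hC hCb).le_innerMass hg hν hCV)

/-- A packing nearly optimal in `Fᶜ` is removed: whatever fits into the remaining neighbourhood of
`F` is disjoint from it. -/
theorem exists_open_innerMass_le (hg : genus Y = 0) (hν : IsSolidSetFunction ν) {F O : Set Y}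
    (hO : IsOpen O) (hFO : F ⊆ O) {ε : ℝ} (hε : 0 < ε) :
    ∃ U, IsOpen U ∧ F ⊆ U ∧ U ⊆ O ∧ innerMass ν U ≤ ν univ - innerMass ν Fᶜ + ε := by
  obtain ⟨r, ⟨K, hK, hr⟩, hlt⟩ := exists_lt_of_lt_csSup
    (⟨0, ∅, empty_subset _, HasMass.empty⟩ : {r | ∃ K, K ⊆ Fᶜ ∧ HasMass ν K r}.Nonempty)
    (sub_lt_self (innerMass ν Fᶜ) hε)
  refine ⟨Kᶜ ∩ O, hr.isClosed.isOpen_compl.inter hO,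
    subset_inter (subset_compl_comm.1 hK) hFO, inter_subset_right, ?_⟩
  refine innerMass_le fun L s hL hs => ?_
  have := (hs.union hr (subset_compl_iff_disjoint_right.1
    (hL.trans inter_subset_left))).le_univ hg hν
  linarith

theorem sub_innerMass_compl_le (hg : genus Y = 0) (hν : IsSolidSetFunction ν) {F U : Set Y}
    (hF : IsClosed F) (hU : IsOpen U) (hFU : F ⊆ U) :
    ν univ - innerMass ν Fᶜ ≤ innerMass ν U := by
  have := innerMass_union_add_inter hg hν hU hF.isOpen_compl
    (eq_univ_iff_forall.2 fun z => or_iff_not_imp_right.2 fun h => hFU (not_not.1 h))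
  have h0 := innerMass_nonneg hg hν (U ∩ Fᶜ)
  linarith

end InnerMass

/-! ### Local connectedness and solid sets in the one-point compactification -/

section OnePoint

variable {X : Type*} [TopologicalSpace X]

theorem infty_mem_closure_of_not_bounded [T2Space X] {V : Set X} (h : ¬ Bounded V) :
    (OnePoint.infty : OnePoint X) ∈ closure ((fun x : X => (x : OnePoint X)) '' V) := by
  rw [mem_closure_iff_nhds_basis OnePoint.hasBasis_nhds_infty]
  rintro S ⟨hSc, hS⟩
  by_contra! hno
  refine h (hS.of_isClosed_subset isClosed_closure (closure_minimal (fun v hv => ?_) hSc))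
  by_contra hvS
  exact hno _ ⟨v, hv, rfl⟩ (Or.inl ⟨v, hvS, rfl⟩)

theorem isPreconnected_component_union_infty [T2Space X] {W : Set X} {x : X}
    (h : ¬ Bounded (connectedComponentIn W x)) :
    IsPreconnected ((fun x : X => (x : OnePoint X)) '' connectedComponentIn W x ∪
      {OnePoint.infty}) :=
  isPreconnected_union_of_closure
    (isPreconnected_connectedComponentIn.image _ OnePoint.continuous_coe.continuousOn)
    isPreconnected_singleton ⟨_, infty_mem_closure_of_not_bounded h, rfl⟩

/-- Outside a nonempty compact set, the bounded components stay in a compact set. -/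
theorem exists_compact_bounded_components [T2Space X] [LocallyCompactSpace X] [ConnectedSpace X]
    [LocallyConnectedSpace X] {K : Set X} (hK : IsCompact K) (hne : K.Nonempty) :
    ∃ S, IsCompact S ∧ ∀ x ∉ S, x ∈ Kᶜ ∧ ¬ Bounded (connectedComponentIn Kᶜ x) := by
  obtain ⟨K', hK', hKK'⟩ := exists_compact_superset hK
  have hWo : IsOpen Kᶜ := hK.isClosed.isOpen_compl
  have hfr : frontier K' ⊆ Kᶜ := fun z hz hzK => hz.2 (hKK' hzK)
  have hfin := finite_components_meeting hWo
    (hK'.of_isClosed_subset isClosed_frontier hK'.isClosed.frontier_subset) hfr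
  refine ⟨K' ∪ ⋃ V ∈ {V | (∃ x ∈ frontier K', V = connectedComponentIn Kᶜ x) ∧ Bounded V},
    closure V, hK'.union ((hfin.subset fun V hV => hV.1).isCompact_biUnion fun V hV => hV.2), ?_⟩
  intro x hx
  have hxK : x ∈ Kᶜ := fun h => hx (Or.inl (interior_subset (hKK' h)))
  refine ⟨hxK, fun hb => ?_⟩
  by_cases hd : ∃ z ∈ frontier K', z ∈ connectedComponentIn Kᶜ x
  · obtain ⟨z, hz, hzx⟩ := hd
    exact hx (Or.inr (mem_iUnion₂.2 ⟨_, ⟨⟨z, hz, connectedComponentIn_eq hzx⟩, hb⟩,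
      subset_closure (mem_connectedComponentIn hxK)⟩))
  · have hcov : connectedComponentIn Kᶜ x ⊆ interior K' ∪ K'ᶜ := by
      intro z hz
      by_cases hzK : z ∈ K'
      · exact Or.inl (by_contra fun h => hd ⟨z, ⟨subset_closure hzK, h⟩, hz⟩)
      · exact Or.inr hzK
    rcases isPreconnected_connectedComponentIn.subset_or_subset isOpen_interior
      hK'.isClosed.isOpen_compl (disjoint_compl_right.mono_left interior_subset) hcov with h | h
    · exact hx (Or.inl (interior_subset (h (mem_connectedComponentIn hxK))))
    -- A component outside `K'` has closure disjoint from `K`, so it would be clopen in the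
    -- connected space `X` and contain `k`.
    · obtain ⟨k, hk⟩ := hne
      have := subset_component_of_isPreconnected hWo isPreconnected_univ hxK (subset_univ _) ?_
      · exact connectedComponentIn_subset _ _ (this (mem_univ k)) hk
      · rintro z ⟨hz, -⟩ hzK
        have := closure_mono h hz
        rw [closure_compl] at this
        exact this (hKK' hzK)

theorem locallyConnectedSpace_onePoint [T2Space X] [LocallyCompactSpace X] [ConnectedSpace X]
    [LocallyConnectedSpace X] : LocallyConnectedSpace (OnePoint X) := by
  rw [locallyConnectedSpace_iff_connected_subsets]
  intro y U hU
  induction y using OnePoint.rec with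
  | infty =>
    obtain ⟨K, ⟨hKc, hK⟩, hKU⟩ := OnePoint.hasBasis_nhds_infty.mem_iff.1 hU
    obtain ⟨x₀⟩ : Nonempty X := inferInstance
    -- The point `x₀` makes the compact set nonempty. The unbounded components of its complement,
    -- joined at infinity, form a connected neighbourhood of infinity.
    obtain ⟨S, hS, h⟩ := exists_compact_bounded_components (hK.insert x₀) (insert_nonempty x₀ K)
    refine ⟨(fun x : X => (x : OnePoint X)) '' {x | x ∈ (insert x₀ K)ᶜ ∧
      ¬ Bounded (connectedComponentIn (insert x₀ K)ᶜ x)} ∪ {OnePoint.infty}, ?_, ?_, ?_⟩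
    · refine OnePoint.hasBasis_nhds_infty.mem_iff.2 ⟨S, ⟨hS.isClosed, hS⟩, ?_⟩
      exact union_subset_union_left _ (image_mono fun x hx => h x hx)
    · refine isPreconnected_of_forall OnePoint.infty ?_
      rintro _ (⟨x, ⟨hx, hb⟩, rfl⟩ | rfl)
      · refine ⟨_, union_subset_union_left _ (image_mono fun z hz => ?_), Or.inr rfl,
          Or.inl ⟨x, mem_connectedComponentIn hx, rfl⟩, isPreconnected_component_union_infty hb⟩
        exact ⟨connectedComponentIn_subset _ _ hz, connectedComponentIn_eq hz ▸ hb⟩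
      · exact ⟨{OnePoint.infty}, subset_union_right, rfl, rfl, isPreconnected_singleton⟩
    · exact (union_subset_union_left _ (image_mono fun x hx h => hx.1 (Or.inr h))).trans hKU
  | coe x =>
    rw [OnePoint.nhds_coe_eq, Filter.mem_map] at hU
    obtain ⟨V, hV, hVc, hVU⟩ := locallyConnectedSpace_iff_connected_subsets.1
      ‹LocallyConnectedSpace X› x _ hU
    exact ⟨_, OnePoint.nhds_coe_eq x ▸ Filter.image_mem_map hV,
      hVc.image _ OnePoint.continuous_coe.continuousOn, image_subset_iff.2 hVU⟩

/-- A component of a closed set in a locally compact space that is contained in a compact set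
is contained in relatively clopen compact sets close to it. -/
theorem exists_compact_relatively_open [T2Space X] [LocallyCompactSpace X] {F : Set X}
    (hF : IsClosed F) {x : X} (hx : x ∈ F) (hb : Bounded (connectedComponentIn F x)) :
    ∃ D G : Set X, IsCompact D ∧ IsOpen G ∧ x ∈ D ∧ D = F ∩ G := by
  obtain ⟨S, hS, hsub⟩ := exists_compact_superset hb
  have hxS : x ∈ interior S := hsub (subset_closure (mem_connectedComponentIn hx))
  have hZ : IsCompact (F ∩ S) := hS.inter_left hF
  have := isCompact_iff_compactSpace.1 hZ
  let z : ↥(F ∩ S) := ⟨x, hx, interior_subset hxS⟩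
  have hcomp : ((↑) : ↥(F ∩ S) → X) '' connectedComponent z ⊆ interior S := by
    refine Subset.trans ?_ (subset_closure.trans hsub)
    refine (isPreconnected_connectedComponent.image _
      continuous_subtype_val.continuousOn).subset_connectedComponentIn
      ⟨z, mem_connectedComponent, rfl⟩ ?_
    rintro _ ⟨w, -, rfl⟩
    exact w.2.1
  have : Nonempty {s : Set ↥(F ∩ S) // IsClopen s ∧ z ∈ s} := ⟨⟨univ, isClopen_univ, mem_univ z⟩⟩
  -- In the compact space `F ∩ S` a component is the intersection of the clopen sets around it, so
  -- one of these already lies in `interior S`.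
  have key := exists_subset_nhds_of_compactSpace
    (V := fun s : {s : Set ↥(F ∩ S) // IsClopen s ∧ z ∈ s} => (s : Set ↥(F ∩ S)))
    (U := ((↑) : ↥(F ∩ S) → X) ⁻¹' interior S) ?_ (fun s => s.2.1.1) ?_
  · obtain ⟨⟨D, hD, hzD⟩, hDS⟩ := key
    obtain ⟨G, hG, rfl⟩ := isOpen_induced_iff.1 hD.2
    refine ⟨((↑) : ↥(F ∩ S) → X) '' (((↑) : ↥(F ∩ S) → X) ⁻¹' G), G ∩ interior S,
      hD.1.isCompact.image continuous_subtype_val, hG.inter isOpen_interior, ⟨z, hzD, rfl⟩, ?_⟩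
    ext w
    constructor
    · rintro ⟨v, hv, rfl⟩
      exact ⟨v.2.1, hv, hDS hv⟩
    · rintro ⟨h1, h2, h3⟩
      exact ⟨⟨w, h1, interior_subset h3⟩, h2, rfl⟩
  · rintro ⟨s, hs, hzs⟩ ⟨t, ht, hzt⟩
    exact ⟨⟨s ∩ t, hs.inter ht, hzs, hzt⟩, inter_subset_left, inter_subset_right⟩
  · rw [← connectedComponent_eq_iInter_isClopen]
    intro w hw
    exact (isOpen_interior.preimage continuous_subtype_val).mem_nhds (hcomp ⟨w, hw, rfl⟩)

/-- Unbounded components of the complement accumulate at infinity and are joined there. Conversely,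
a bounded one would separate the complement from infinity: for closed `A` the component itself is
relatively clopen; for open `A` it need not be, and a compact relatively open set around the point
takes its place. -/
theorem isSolid_iff_biconnected_image [T2Space X] [LocallyCompactSpace X] [NoncompactSpace X]
    [LocallyConnectedSpace X] {A : Set X} (hA : IsClosed A ∨ IsOpen A) :
    IsSolid A ↔ Biconnected ((fun x : X => (x : OnePoint X)) '' A) := by
  have hnc : ¬ CompactSpace X := not_compactSpace_iff.2 inferInstance
  refine and_congr (OnePoint.isOpenEmbedding_coe.isInducing.isPreconnected_image).symm ?_
  have hco : ((fun x : X => (x : OnePoint X)) '' A)ᶜ =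
      (fun x : X => (x : OnePoint X)) '' Aᶜ ∪ {OnePoint.infty} := OnePoint.compl_image_coe A
  have hcoe : ∀ {x : X}, x ∈ Aᶜ → (x : OnePoint X) ∈ ((fun x : X => (x : OnePoint X)) '' A)ᶜ :=
    fun hx => hco ▸ Or.inl ⟨_, hx, rfl⟩
  have hinf : OnePoint.infty ∈ ((fun x : X => (x : OnePoint X)) '' A)ᶜ := hco ▸ Or.inr rfl
  constructor
  · rintro ⟨-, h⟩
    rw [hco]
    refine isPreconnected_of_forall OnePoint.infty ?_
    rintro _ (⟨x, hx, rfl⟩ | rfl)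
    · exact ⟨_, union_subset_union_left _ (image_mono (connectedComponentIn_subset _ _)), Or.inr rfl,
        Or.inl ⟨x, mem_connectedComponentIn hx, rfl⟩,
        isPreconnected_component_union_infty (h hnc x hx)⟩
    · exact ⟨{OnePoint.infty}, subset_union_right, rfl, rfl, isPreconnected_singleton⟩
  · refine fun h => ⟨fun h' => absurd h' hnc, fun _ x hx hb => ?_⟩
    rcases hA with hA | hA
    · refine OnePoint.infty_notMem_image_coe (h.subset_of_closure_inter_subset
        (OnePoint.isOpen_image_coe.2 (hA.isOpen_compl.connectedComponentIn (x := x)))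
        ⟨x, hcoe hx, x, mem_connectedComponentIn hx, rfl⟩ ?_ hinf)
      rintro z ⟨hz1, hz2⟩
      obtain ⟨w, hw, rfl⟩ := closure_minimal (image_mono subset_closure)
        (hb.image OnePoint.continuous_coe).isClosed hz1
      exact ⟨w, closure_component_inter_subset _ _ ⟨hw, fun hwA => hz2 ⟨w, hwA, rfl⟩⟩, rfl⟩
    · obtain ⟨D, G, hD, hG, hxD, hDG⟩ := exists_compact_relatively_open hA.isClosed_compl hx hb
      have hDc : IsClosed ((fun x : X => (x : OnePoint X)) '' D) :=
        (hD.image OnePoint.continuous_coe).isClosed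
      have hcov : ((fun x : X => (x : OnePoint X)) '' A)ᶜ ⊆
          (fun x : X => (x : OnePoint X)) '' G ∪ ((fun x : X => (x : OnePoint X)) '' D)ᶜ := by
        intro z hz
        by_cases hzD : z ∈ (fun x : X => (x : OnePoint X)) '' D
        · obtain ⟨w, hw, rfl⟩ := hzD
          exact Or.inl ⟨w, (hDG ▸ hw : w ∈ Aᶜ ∩ G).2, rfl⟩
        · exact Or.inr hzD
      obtain ⟨z, hz, ⟨w, hw, rfl⟩, hz2⟩ := h ((fun x : X => (x : OnePoint X)) '' G)
        ((fun x : X => (x : OnePoint X)) '' D)ᶜ (OnePoint.isOpen_image_coe.2 hG) hDc.isOpen_compl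
        hcov ⟨x, hcoe hx, x, (hDG ▸ hxD : x ∈ Aᶜ ∩ G).2, rfl⟩
        ⟨OnePoint.infty, hinf, OnePoint.infty_notMem_image_coe⟩
      exact hz2 ⟨w, hDG ▸ ⟨fun hwA => hz ⟨w, hwA, rfl⟩, hw⟩, rfl⟩

end OnePoint

/-! ### The extension from open sets to all sets -/

section Coe

variable {X : Type*} [TopologicalSpace X] {ν : Set (OnePoint X) → ℝ≥0}

theorem image_preimage_coe {A : Set (OnePoint X)} (h : OnePoint.infty ∉ A) :
    (fun x : X => (x : OnePoint X)) '' ((fun x : X => (x : OnePoint X)) ⁻¹' A) = A := by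
  refine image_preimage_eq_of_subset fun z hz => ?_
  induction z using OnePoint.rec with
  | infty => exact absurd hz h
  | coe x => exact ⟨x, rfl⟩

theorem isCompact_preimage_coe {C : Set (OnePoint X)} (hC : IsClosed C)
    (hi : OnePoint.infty ∉ C) : IsCompact ((fun x : X => (x : OnePoint X)) ⁻¹' C) := by
  rw [OnePoint.isOpenEmbedding_coe.isInducing.isCompact_iff]
  exact (image_preimage_coe hi).symm ▸ hC.isCompact

theorem image_coe_disjoint {A B : Set X} (h : Disjoint A B) :
    Disjoint ((fun x : X => (x : OnePoint X)) '' A) ((fun x : X => (x : OnePoint X)) '' B) :=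
  (disjoint_image_iff OnePoint.coe_injective).2 h

/-- The set function on `X` whose value on open sets is the inner mass, and which is outer
regular. -/
noncomputable def extension (ν : Set (OnePoint X) → ℝ≥0) (A : Set X) : ℝ≥0∞ :=
  ⨅ U ∈ {U : Set X | IsOpen U ∧ A ⊆ U},
    ENNReal.ofReal (innerMass ν ((fun x : X => (x : OnePoint X)) '' U))

theorem extension_mono {A B : Set X} (h : A ⊆ B) : extension ν A ≤ extension ν B :=
  biInf_mono fun _ hU => ⟨hU.1, h.trans hU.2⟩

theorem ofReal_innerMass_le {Y : Type*} [TopologicalSpace Y] {ν : Set Y → ℝ≥0} {U : Set Y}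
    {x : ℝ≥0∞} (h : ∀ K r, K ⊆ U → HasMass ν K r → ENNReal.ofReal r ≤ x) :
    ENNReal.ofReal (innerMass ν U) ≤ x := by
  rcases eq_or_ne x ∞ with rfl | hx
  · exact le_top
  · rw [ENNReal.ofReal_le_iff_le_toReal hx]
    exact innerMass_le fun K r hK hr => (ENNReal.ofReal_le_iff_le_toReal hx).1 (h K r hK hr)

end Coe

/-! ### Restriction to `X` and existence of the topological measure -/

section Restrict

variable {X : Type*} [TopologicalSpace X] [T2Space X] [LocallyCompactSpace X] [NoncompactSpace X]
  [ConnectedSpace X] [LocallyConnectedSpace X] {ν : Set (OnePoint X) → ℝ≥0}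

theorem image_mem_compactSolid_iff {A : Set X} :
    (fun x : X => (x : OnePoint X)) '' A ∈ compactSolid (OnePoint X) ↔ A ∈ compactSolid X := by
  have hcomp : IsCompact ((fun x : X => (x : OnePoint X)) '' A) ↔ IsCompact A :=
    OnePoint.isOpenEmbedding_coe.isInducing.isCompact_iff.symm
  constructor
  · intro h
    have hA := hcomp.1 h.1
    exact ⟨hA, (isSolid_iff_biconnected_image (Or.inl hA.isClosed)).2
      (isSolid_iff_biconnected.1 h.2)⟩
  · intro h
    exact ⟨hcomp.2 h.1, isSolid_iff_biconnected.2
      ((isSolid_iff_biconnected_image (Or.inl h.1.isClosed)).1 h.2)⟩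

theorem image_mem_openSolid {A : Set X} (h : A ∈ openSolid X) :
    (fun x : X => (x : OnePoint X)) '' A ∈ openSolid (OnePoint X) :=
  mem_openSolid_iff.2 ⟨OnePoint.isOpen_image_coe.2 h.1,
    (isSolid_iff_biconnected_image (Or.inr h.1)).1 h.2.2⟩

theorem image_mem_boundedSolid {A : Set X} (h : A ∈ boundedSolid X) :
    (fun x : X => (x : OnePoint X)) '' A ∈ boundedSolid (OnePoint X) :=
  h.imp image_mem_compactSolid_iff.2 image_mem_openSolid

/-- Missing infinity is not enough for an open set to be bounded in `X`; its closure must miss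
infinity too. -/
theorem preimage_mem_openSolid {V : Set (OnePoint X)} (hV : IsOpen V) (hVb : Biconnected V)
    (hinf : OnePoint.infty ∉ closure V) :
    (fun x : X => (x : OnePoint X)) ⁻¹' V ∈ openSolid X := by
  have ho : IsOpen ((fun x : X => (x : OnePoint X)) ⁻¹' V) := hV.preimage OnePoint.continuous_coe
  refine ⟨ho, ?_, (isSolid_iff_biconnected_image (Or.inr ho)).2 ?_⟩
  · have hc := isCompact_preimage_coe (X := X) isClosed_closure hinf
    exact hc.of_isClosed_subset isClosed_closure
      (closure_minimal (preimage_mono subset_closure) hc.isClosed)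
  · rwa [image_preimage_coe fun h => hinf (subset_closure h)]

theorem isSolidSetFunction_restrict (hg : genus (OnePoint X) = 0) (hν : IsSolidSetFunction ν) :
    IsSolidSetFunction (restrict ν) := by
  have := locallyConnectedSpace_onePoint (X := X)
  refine ⟨?_, ?_, ?_, ?_⟩
  · intro n K C hK hC hd hsub
    refine hν.superadditive n (fun i => _ '' K i) _ (fun i => image_mem_compactSolid_iff.2 (hK i))
      (image_mem_compactSolid_iff.2 hC) (fun i j hij => image_coe_disjoint (hd hij)) ?_
    rw [← image_iUnion]
    exact image_mono hsub
  · intro U hU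
    have := hν.inner_regular _ (image_mem_openSolid hU)
    have heq : restrict ν '' {K | K ∈ compactSolid X ∧ K ⊆ U} =
        ν '' {K | K ∈ compactSolid (OnePoint X) ∧ K ⊆ (fun x : X => (x : OnePoint X)) '' U} := by
      ext r
      constructor
      · rintro ⟨K, ⟨hK, hKU⟩, rfl⟩
        exact ⟨_, ⟨image_mem_compactSolid_iff.2 hK, image_mono hKU⟩, rfl⟩
      · rintro ⟨K, ⟨hK, hKU⟩, rfl⟩
        have himg := image_preimage_coe (X := X) (A := K)
          fun h => OnePoint.infty_notMem_image_coe (hKU h)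
        refine ⟨(fun x : X => (x : OnePoint X)) ⁻¹' K, ⟨?_, ?_⟩, ?_⟩
        · rw [← image_mem_compactSolid_iff, himg]
          exact hK
        · exact (image_subset_image_iff OnePoint.coe_injective).1 (himg.trans_subset hKU)
        · rw [restrict, himg]
    rw [heq]
    exact this
  · intro K hK
    have hK' := image_mem_compactSolid_iff.2 hK
    have hKb := mem_compactSolid_iff.1 hK'
    have hreg := hν.outer_regular _ hK'
    refine ⟨?_, fun b hb => hreg.2 ?_⟩
    · rintro _ ⟨U, ⟨hU, hKU⟩, rfl⟩
      exact hreg.1 ⟨_, ⟨image_mem_openSolid hU, image_mono hKU⟩, rfl⟩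
    · rintro _ ⟨U, ⟨hU, hKU⟩, rfl⟩
      have hU' := mem_openSolid_iff.1 hU
      -- A solid neighbourhood in the compactification may reach infinity, so it is first shrunk to
      -- one with closure inside `X`.
      obtain ⟨V, h1, h2, h3, h4⟩ := exists_open_biconnected_between hKb.1 hKb.2
        (hU'.1.inter OnePoint.isOpen_range_coe) (subset_inter hKU (image_subset_range _ _))
      have hinf : OnePoint.infty ∉ closure V := fun h => OnePoint.infty_notMem_range_coe (h4 h).2
      have himg := image_preimage_coe (X := X) (A := V) fun h => hinf (subset_closure h)
      have hb' := hb ⟨_, ⟨preimage_mem_openSolid h1 h2 hinf, image_subset_iff.1 h3⟩, rfl⟩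
      rw [restrict, himg] at hb'
      exact hb'.trans (NNReal.coe_le_coe.1 (hν.mono_open hg h1 h2 hU'.1 hU'.2
        (subset_closure.trans (h4.trans inter_subset_left))))
  · intro n B A hB hA hd hAB
    refine hν.additive n (fun i => _ '' B i) _ (fun i => image_mem_boundedSolid (hB i))
      (image_mem_boundedSolid hA) (fun i j hij => image_coe_disjoint (hd hij)) ?_
    rw [hAB, image_iUnion]

theorem extension_open (hg : genus (OnePoint X) = 0) (hν : IsSolidSetFunction ν) {U : Set X}
    (hU : IsOpen U) : extension ν U =
      ENNReal.ofReal (innerMass ν ((fun x : X => (x : OnePoint X)) '' U)) := by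
  have := locallyConnectedSpace_onePoint (X := X)
  refine le_antisymm (iInf₂_le U ⟨hU, Subset.rfl⟩) (le_iInf₂ fun V hV => ?_)
  exact ENNReal.ofReal_le_ofReal (innerMass_mono hg hν (image_mono hV.2))

/-- Total mass minus the inner mass of the complement is the infimum over open neighbourhoods; these
may be taken inside `X`. -/
theorem extension_compact (hg : genus (OnePoint X) = 0) (hν : IsSolidSetFunction ν) {K : Set X}
    (hK : IsCompact K) : extension ν K =
      ENNReal.ofReal (ν univ - innerMass ν ((fun x : X => (x : OnePoint X)) '' K)ᶜ) := by
  have := locallyConnectedSpace_onePoint (X := X)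
  have hKc : IsClosed ((fun x : X => (x : OnePoint X)) '' K) :=
    (hK.image OnePoint.continuous_coe).isClosed
  refine le_antisymm ?_ (le_iInf₂ fun V hV => ?_)
  · have hnn : 0 ≤ ν univ - innerMass ν ((fun x : X => (x : OnePoint X)) '' K)ᶜ := by
      rw [← innerMass_univ hg hν]
      exact sub_nonneg.2 (innerMass_mono hg hν (subset_univ _))
    refine ENNReal.le_of_forall_pos_le_add fun ε hε _ => ?_
    obtain ⟨U, h1, h2, h3, h4⟩ := exists_open_innerMass_le hg hν (ε := ε)
      OnePoint.isOpen_range_coe (image_subset_range (fun x : X => (x : OnePoint X)) K) hε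
    have himg := image_preimage_coe (X := X) (A := U)
      fun h => OnePoint.infty_notMem_range_coe (h3 h)
    refine (iInf₂_le ((fun x : X => (x : OnePoint X)) ⁻¹' U)
      ⟨h1.preimage OnePoint.continuous_coe, image_subset_iff.1 h2⟩).trans ?_
    rw [himg, ← ENNReal.ofReal_coe_nnreal, ← ENNReal.ofReal_add hnn ε.coe_nonneg]
    exact ENNReal.ofReal_le_ofReal h4
  · exact ENNReal.ofReal_le_ofReal (sub_innerMass_compl_le hg hν hKc
      (OnePoint.isOpen_image_coe.2 hV.1) (image_mono hV.2))

theorem extension_add (hg : genus (OnePoint X) = 0) (hν : IsSolidSetFunction ν) {A B : Set X}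
    (hA : IsCompact A ∨ IsOpen A) (hB : IsCompact B ∨ IsOpen B)
    (hAB : IsCompact (A ∪ B) ∨ IsOpen (A ∪ B)) (hd : Disjoint A B) :
    extension ν (A ∪ B) = extension ν A + extension ν B := by
  have := locallyConnectedSpace_onePoint (X := X)
  have hnn : ∀ U : Set (OnePoint X), 0 ≤ ν univ - innerMass ν U := fun U => by
    rw [← innerMass_univ hg hν]
    exact sub_nonneg.2 (innerMass_mono hg hν (subset_univ _))
  have hcl : ∀ {K : Set X}, IsCompact K →
      IsOpen ((fun x : X => (x : OnePoint X)) '' K)ᶜ := fun hK =>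
    (hK.image OnePoint.continuous_coe).isClosed.isOpen_compl
  -- If the union is compact, `U` and the complement of the union partition the complement of `K`.
  -- If it is open, it and the complement of `K` cover the space and meet in `U`.
  have hmixed : ∀ {K U : Set X}, IsCompact K → IsOpen U → (IsCompact (K ∪ U) ∨ IsOpen (K ∪ U)) →
      Disjoint K U → extension ν (K ∪ U) = extension ν K + extension ν U := by
    intro K U hK hU hKU hd
    have hd' := image_coe_disjoint hd
    have hU' := OnePoint.isOpen_image_coe.2 hU
    rw [extension_compact hg hν hK, extension_open hg hν hU,
      ← ENNReal.ofReal_add (hnn _) (innerMass_nonneg hg hν _)]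
    rcases hKU with h | h
    · rw [extension_compact hg hν h]
      have h1 := innerMass_union_of_disjoint hg hν hU' (hcl h)
        (disjoint_compl_right_iff_subset.2 (image_mono subset_union_right))
      have h2 : (fun x : X => (x : OnePoint X)) '' U ∪ ((fun x : X => (x : OnePoint X)) '' (K ∪ U))ᶜ
          = ((fun x : X => (x : OnePoint X)) '' K)ᶜ := by
        rw [image_union, compl_union, union_inter_distrib_left, union_compl_self, inter_univ]
        exact union_eq_self_of_subset_left hd'.subset_compl_left
      rw [h2] at h1
      congr 1
      linarith
    · rw [extension_open hg hν h]
      have h1 := innerMass_union_add_inter hg hν (OnePoint.isOpen_image_coe.2 h) (hcl hK) ?_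
      · have h2 : (fun x : X => (x : OnePoint X)) '' (K ∪ U) ∩
            ((fun x : X => (x : OnePoint X)) '' K)ᶜ = (fun x : X => (x : OnePoint X)) '' U := by
          rw [image_union, union_inter_distrib_right, inter_compl_self, empty_union]
          exact inter_eq_self_of_subset_left hd'.subset_compl_left
        rw [h2] at h1
        congr 1
        linarith
      · rw [image_union, union_right_comm, union_compl_self, univ_union]
  rcases hA with hA | hA <;> rcases hB with hB | hB
  · rw [extension_compact hg hν (hA.union hB), extension_compact hg hν hA,
      extension_compact hg hν hB, ← ENNReal.ofReal_add (hnn _) (hnn _)]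
    have h1 := innerMass_union_add_inter hg hν (hcl hA) (hcl hB) (by
      rw [← compl_inter, disjoint_iff_inter_eq_empty.1 (image_coe_disjoint hd), compl_empty])
    rw [← compl_union, ← image_union] at h1
    congr 1
    linarith
  · exact hmixed hA hB hAB hd
  · rw [union_comm, add_comm]
    rw [union_comm] at hAB
    exact hmixed hB hA hAB hd.symm
  · rw [extension_open hg hν (hA.union hB), extension_open hg hν hA, extension_open hg hν hB,
      ← ENNReal.ofReal_add (innerMass_nonneg hg hν _) (innerMass_nonneg hg hν _), image_union,
      innerMass_union_of_disjoint hg hν (OnePoint.isOpen_image_coe.2 hA)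
      (OnePoint.isOpen_image_coe.2 hB) (image_coe_disjoint hd)]

theorem isTopologicalMeasure_extension (hg : genus (OnePoint X) = 0)
    (hν : IsSolidSetFunction ν) : IsTopologicalMeasure (extension ν : Set X → ℝ≥0∞) := by
  have := locallyConnectedSpace_onePoint (X := X)
  refine ⟨⟨∅, Or.inl isOpen_empty, ?_⟩, fun A B hA hB hAB hd => extension_add hg hν hA hB hAB hd,
    fun U hU => le_antisymm ?_ ?_, fun F hF => ?_⟩
  · rw [extension_open hg hν isOpen_empty]
    exact ENNReal.ofReal_ne_top
  · rw [extension_open hg hν hU]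
    refine ofReal_innerMass_le fun K r hK hr => ?_
    have himg := image_preimage_coe (X := X) (A := K)
      fun h => OnePoint.infty_notMem_image_coe (hK h)
    have hKc := isCompact_preimage_coe (X := X) hr.isClosed
      fun h => OnePoint.infty_notMem_image_coe (hK h)
    refine le_trans ?_ (le_sSup ⟨_, ⟨hKc,
      (image_subset_image_iff OnePoint.coe_injective).1 (himg.trans_subset hK)⟩, rfl⟩)
    rw [extension_compact hg hν hKc, himg]
    refine ENNReal.ofReal_le_ofReal ?_
    rw [le_sub_comm]
    refine innerMass_le fun L s hL hs => ?_
    have := (hs.union hr (subset_compl_iff_disjoint_right.1 hL)).le_univ hg hν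
    linarith
  · exact sSup_le (by rintro _ ⟨K, ⟨-, hK⟩, rfl⟩; exact extension_mono hK)
  · rw [sInf_image]
    exact biInf_congr fun U hU => (extension_open hg hν hU.1).symm

theorem extends_extension (hg : genus (OnePoint X) = 0) (hν : IsSolidSetFunction ν) :
    Extends (extension ν : Set X → ℝ≥0∞) (restrict ν) := by
  have := locallyConnectedSpace_onePoint (X := X)
  rintro A (hA | hA)
  · have hA' := mem_compactSolid_iff.1 (image_mem_compactSolid_iff.2 hA)
    rw [extension_compact hg hν hA.1, innerMass_of_biconnected hg hν hA'.1.isOpen_compl hA'.2.compl,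
      ← hν.map_compl hA'.1 hA'.2, ENNReal.ofReal_coe_nnreal]
    rfl
  · have hA' := mem_openSolid_iff.1 (image_mem_openSolid hA)
    rw [extension_open hg hν hA.1, innerMass_of_biconnected hg hν hA'.1 hA'.2,
      ENNReal.ofReal_coe_nnreal]
    rfl

end Restrict

/-! ### Uniqueness of the extension -/

section Uniqueness

variable {X : Type*} [TopologicalSpace X] [T2Space X] [LocallyCompactSpace X] [NoncompactSpace X]
  [ConnectedSpace X] [LocallyConnectedSpace X] {ν : Set (OnePoint X) → ℝ≥0}
  {μ : Set X → ℝ≥0∞}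

/-- Infinity lies in one hole `V₀`. The compact solid set `V₀ᶜ` is the carrier together with the
other holes, which are bounded because `V₀` is a neighbourhood of infinity disjoint from them. All
values but that of the carrier are prescribed and finite. -/
theorem IsTopologicalMeasure.preimage_carrier (hν : IsSolidSetFunction ν)
    (hμ : IsTopologicalMeasure μ) (hext : Extends μ (restrict ν)) {𝓥 : Finset (Set (OnePoint X))}
    (h : IsCoFamily 𝓥) (hinf : OnePoint.infty ∉ carrier 𝓥) :
    μ ((fun x : X => (x : OnePoint X)) ⁻¹' carrier 𝓥) = ENNReal.ofReal (weight ν 𝓥) := by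
  classical
  obtain ⟨V₀, hV₀, hinf₀⟩ : ∃ V ∈ 𝓥, OnePoint.infty ∈ V := by
    by_contra! h'
    exact hinf (mem_carrier.2 h')
  have hcl : ∀ V ∈ 𝓥, V ≠ V₀ → OnePoint.infty ∉ closure V := fun V hV hne hc => by
    obtain ⟨z, hz1, hz2⟩ := mem_closure_iff.1 hc V₀ (h.isOpen V₀ hV₀) hinf₀
    exact Set.disjoint_left.1 (h.disjoint hV hV₀ hne) hz2 hz1
  have hval : ∀ V ∈ 𝓥, V ≠ V₀ → μ ((fun x : X => (x : OnePoint X)) ⁻¹' V) = ν V :=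
    fun V hV hne => by
    rw [hext _ (Or.inr (preimage_mem_openSolid (h.isOpen V hV) (h.biconnected V hV)
      (hcl V hV hne))), restrict, image_preimage_coe fun hi => hcl V hV hne (subset_closure hi)]
  have hopen : ∀ t : Finset (Set (OnePoint X)), t ⊆ 𝓥 →
      IsOpen ((fun x : X => (x : OnePoint X)) ⁻¹' ⋃₀ (t : Set (Set (OnePoint X)))) := fun t ht =>
    (isOpen_sUnion fun V hV => h.isOpen V (ht hV)).preimage OnePoint.continuous_coe
  have hsum : ∀ t ⊆ 𝓥.erase V₀,
      μ ((fun x : X => (x : OnePoint X)) ⁻¹' ⋃₀ (t : Set (Set (OnePoint X)))) =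
        ∑ V ∈ t, (ν V : ℝ≥0∞) := by
    intro t
    induction t using Finset.induction_on with
    | empty =>
      intro _
      have hs : (∅ : Set X) ∈ compactSolid X := image_mem_compactSolid_iff.1 (by
        rw [image_empty]
        exact mem_compactSolid_iff.2 ⟨isClosed_empty, biconnected_empty⟩)
      have := hext ∅ (Or.inl hs)
      rw [restrict, image_empty, hν.map_empty] at this
      simpa using this
    | insert V t hVt ih =>
      intro ht
      have hV := Finset.mem_erase.1 (ht (Finset.mem_insert_self V t))
      have ht' : t ⊆ 𝓥.erase V₀ := (Finset.subset_insert V t).trans ht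
      have ht'' := ht'.trans (Finset.erase_subset V₀ 𝓥)
      have hoV := (h.isOpen V hV.2).preimage (OnePoint.continuous_coe (X := X))
      rw [Finset.coe_insert, sUnion_insert, preimage_union, Finset.sum_insert hVt, ← ih ht',
        ← hval V hV.2 hV.1]
      refine hμ.additive _ _ (Or.inr hoV) (Or.inr (hopen t ht''))
        (Or.inr (hoV.union (hopen t ht''))) (Disjoint.preimage _ (disjoint_sUnion_right.2
          fun W hW => h.disjoint hV.2 (ht'' hW) ?_))
      rintro rfl
      exact hVt hW
  have hC₀ := (h.isOpen V₀ hV₀).isClosed_compl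
  have hi₀ : OnePoint.infty ∉ V₀ᶜ := fun hi => hi hinf₀
  have hsplit : (fun x : X => (x : OnePoint X)) ⁻¹' V₀ᶜ =
      (fun x : X => (x : OnePoint X)) ⁻¹' carrier 𝓥 ∪ (fun x : X => (x : OnePoint X)) ⁻¹'
        ⋃₀ ((𝓥.erase V₀ : Finset (Set (OnePoint X))) : Set (Set (OnePoint X))) := by
    rw [← preimage_union]
    congr 1
    ext z
    constructor
    · intro hz
      by_cases hzc : z ∈ carrier 𝓥
      · exact Or.inl hzc
      · obtain ⟨V, hV, hzV⟩ := not_not.1 hzc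
        exact Or.inr ⟨V, Finset.mem_erase.2 ⟨fun h => hz (h ▸ hzV), hV⟩, hzV⟩
    · rintro (hz | ⟨V, hV, hzV⟩) hz₀
      · exact mem_carrier.1 hz V₀ hV₀ hz₀
      · have := Finset.mem_erase.1 hV
        exact Set.disjoint_left.1 (h.disjoint this.2 hV₀ this.1) hzV hz₀
  have hμ₀ : μ ((fun x : X => (x : OnePoint X)) ⁻¹' V₀ᶜ) = ν V₀ᶜ := by
    rw [hext _ (Or.inl (image_mem_compactSolid_iff.1 (by
      rw [image_preimage_coe hi₀]
      exact mem_compactSolid_iff.2 ⟨hC₀, (h.biconnected V₀ hV₀).compl⟩))), restrict,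
      image_preimage_coe hi₀]
  have hadd := hμ.additive _ _ (Or.inl (isCompact_preimage_coe h.isClosed hinf))
    (Or.inr (hopen _ (Finset.erase_subset V₀ 𝓥)))
    (Or.inl (hsplit ▸ isCompact_preimage_coe hC₀ hi₀)) (Disjoint.preimage _ (Set.disjoint_left.2
      fun z hz ⟨V, hV, hzV⟩ => mem_carrier.1 hz V (Finset.mem_of_mem_erase hV) hzV))
  rw [← hsplit, hμ₀, hsum _ Subset.rfl] at hadd
  have hfin : ∑ V ∈ 𝓥.erase V₀, (ν V : ℝ≥0∞) ≠ ∞ := by simp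
  have hw : weight ν 𝓥 = ν V₀ᶜ - ∑ V ∈ 𝓥.erase V₀, (ν V : ℝ) := by
    have := hν.map_add_compl (h.isOpen V₀ hV₀) (h.biconnected V₀ hV₀)
    rw [weight, ← Finset.add_sum_erase _ _ hV₀]
    linarith
  rw [ENNReal.eq_sub_of_add_eq hfin hadd.symm, hw,
    ENNReal.ofReal_sub _ (Finset.sum_nonneg fun V _ => (ν V).coe_nonneg),
    ENNReal.ofReal_coe_nnreal, ENNReal.ofReal_sum_of_nonneg fun V _ => (ν V).coe_nonneg]
  simp

theorem IsTopologicalMeasure.preimage_hasMass (hg : genus (OnePoint X) = 0)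
    (hν : IsSolidSetFunction ν) (hμ : IsTopologicalMeasure μ) (hext : Extends μ (restrict ν))
    {K : Set (OnePoint X)} {r : ℝ} (h : HasMass ν K r) (hinf : OnePoint.infty ∉ K) :
    μ ((fun x : X => (x : OnePoint X)) ⁻¹' K) = ENNReal.ofReal r := by
  have := locallyConnectedSpace_onePoint (X := X)
  obtain ⟨n, h⟩ := h
  induction h with
  | empty =>
    have hs : (∅ : Set X) ∈ compactSolid X := image_mem_compactSolid_iff.1 (by
      rw [image_empty]
      exact mem_compactSolid_iff.2 ⟨isClosed_empty, biconnected_empty⟩)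
    have := hext ∅ (Or.inl hs)
    rw [restrict, image_empty, hν.map_empty] at this
    simpa using this
  | cons h1 h2 h3 ih =>
    have hi1 := fun hi => hinf (Or.inl hi)
    have hi2 := fun hi => hinf (Or.inr hi)
    have hc1 := isCompact_preimage_coe h1.isClosed hi1
    have hc2 := isCompact_preimage_coe h3.isClosed hi2
    rw [preimage_union, hμ.additive _ _ (Or.inl hc1) (Or.inl hc2) (Or.inl (hc1.union hc2))
      (h2.preimage _), ih hi2, hμ.preimage_carrier hν hext h1 hi1, ENNReal.ofReal_add]
    · exact HasMass.empty.le_weight hg hν h1 (empty_subset _)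
    · exact HasMass.mono hg hν ⟨_, h3⟩ HasMass.empty (empty_subset _)

theorem IsTopologicalMeasure.open_eq (hg : genus (OnePoint X) = 0)
    (hν : IsSolidSetFunction ν) (hμ : IsTopologicalMeasure μ) (hext : Extends μ (restrict ν))
    {U : Set X} (hU : IsOpen U) :
    μ U = ENNReal.ofReal (innerMass ν ((fun x : X => (x : OnePoint X)) '' U)) := by
  have := locallyConnectedSpace_onePoint (X := X)
  refine le_antisymm ?_ (ofReal_innerMass_le fun K r hK hr => ?_)
  · rw [hμ.inner_regular U hU]
    refine sSup_le ?_
    rintro _ ⟨K, ⟨hK, hKU⟩, rfl⟩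
    obtain ⟨K', r, h1, h2, h3⟩ := exists_hasMass_between ν
      (hK.image OnePoint.continuous_coe).isClosed (OnePoint.isOpen_image_coe.2 hU)
      (image_mono hKU)
    have hi : OnePoint.infty ∉ K' := fun h => OnePoint.infty_notMem_image_coe (h3 h)
    have hsub : K ⊆ (fun x : X => (x : OnePoint X)) ⁻¹' K' :=
      image_subset_iff.1 (h2.trans interior_subset)
    -- Monotonicity on closed sets comes from outer regularity.
    calc μ K ≤ μ ((fun x : X => (x : OnePoint X)) ⁻¹' K') := by
          rw [hμ.outer_regular K hK.isClosed,
            hμ.outer_regular _ (h1.isClosed.preimage OnePoint.continuous_coe)]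
          exact sInf_le_sInf (image_mono fun V hV => ⟨hV.1, hsub.trans hV.2⟩)
      _ = ENNReal.ofReal r := hμ.preimage_hasMass hg hν hext h1 hi
      _ ≤ _ := ENNReal.ofReal_le_ofReal (h1.le_innerMass hg hν h3)
  · have hi : OnePoint.infty ∉ K := fun h => OnePoint.infty_notMem_image_coe (hK h)
    rw [← hμ.preimage_hasMass hg hν hext hr hi, hμ.inner_regular U hU]
    exact le_sSup ⟨_, ⟨isCompact_preimage_coe hr.isClosed hi, (image_subset_image_iff
      OnePoint.coe_injective).1 ((image_preimage_coe hi).trans_subset hK)⟩, rfl⟩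

end Uniqueness

end TopMeas

theorem mainTheorem3 {X : Type*} [TopologicalSpace X] [T2Space X] [LocallyCompactSpace X]
    [NoncompactSpace X] [ConnectedSpace X] [LocallyConnectedSpace X]
    (hgenus : TopMeas.genus (OnePoint X) = 0)
    (ν : Set (OnePoint X) → ℝ≥0) (hν : TopMeas.IsSolidSetFunction ν) :
    TopMeas.IsSolidSetFunction (TopMeas.restrict ν) ∧
      ∃ μ : Set X → ℝ≥0∞,
        TopMeas.IsTopologicalMeasure μ ∧ TopMeas.Extends μ (TopMeas.restrict ν) ∧
          ∀ μ' : Set X → ℝ≥0∞,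
            TopMeas.IsTopologicalMeasure μ' → TopMeas.Extends μ' (TopMeas.restrict ν) →
              ∀ A : Set X, IsOpen A ∨ IsClosed A → μ' A = μ A := by
  have hμ := TopMeas.isTopologicalMeasure_extension hgenus hν
  refine ⟨TopMeas.isSolidSetFunction_restrict hgenus hν, TopMeas.extension ν, hμ,
    TopMeas.extends_extension hgenus hν, fun μ' hμ' hext A hA => ?_⟩
  have hopen : ∀ U : Set X, IsOpen U → μ' U = TopMeas.extension ν U := fun U hU =>
    (hμ'.open_eq hgenus hν hext hU).trans (TopMeas.extension_open hgenus hν hU).symm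
  rcases hA with hA | hA
  · exact hopen A hA
  · rw [hμ'.outer_regular A hA, hμ.outer_regular A hA]
    exact congrArg sInf (image_congr fun U hU => hopen U hU.1)
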